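/- Let $\{X_j, p_{ij}\}$ be an inverse system, indexed by a directed (pre)ordered set, of finite CW complexes, with continuous maps $p_{ij}\colon X_i \to X_j$ for $j \le i$. Let $X$ be a compact Hausdorff space (for example a compact metric space) with continuous maps $h_j\colon X \to X_j$ satisfying $p_{ij}\circ h_i = h_j$ for $j\le i$, such that the induced map $X \to \varprojlim_j X_j$ is a homeomorphism. Let $Y$ be a CW complex, let $m$ be an index and let $f_m\colon X_m \to Y$ be a continuous map. Put $f_j = f_m\circ p_{jm}\colon X_j \to Y$ for $j \ge m$ and $f = f_m\circ h_m\colon X \to Y$. For spaces $A$ and $B$ let $F(A,B)$ be the space of continuous maps $A\to B$ with the compactly generated topology induced by the compact-open topology. Then for every $n \ge 0$ the maps $h_j^*\colon \pi_n(F(X_j,Y); f_j) \to \pi_n(F(X,Y); f)$, $j\ge m$, induce an isomorphism $$\varinjlim_{j \ge m} \pi_n(F(X_j,Y); f_j) \;\cong\; \pi_n(F(X,Y); f),$$ where the direct limit is taken along the maps $p_{ij}^*$. It is an isomorphism of groups for $n\ge 1$ and of based sets for $n = 0$. -/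

import Mathlib

open Set Topology
open scoped unitInterval Topology.Homotopy

/-! ### Function spaces -/

/-- The function space `F(X, Y)`: continuous maps with the compactly generated topology
(k-ification) induced by the compact-open topology. -/
abbrev FunSpace (X Y : Type*) [TopologicalSpace X] [TopologicalSpace Y] : Type _ :=
  CompactCoherentification C(X, Y)

namespace FunSpace

variable {X Y Z : Type*} [TopologicalSpace X] [TopologicalSpace Y] [TopologicalSpace Z]

/-- A continuous map as a point of the function space. -/
noncomputable def of (f : C(X, Y)) : FunSpace X Y := CompactCoherentification.mk _ f

/-- Precomposition `g^* : F(Z, Y) → F(X, Y)`, `u ↦ u ∘ g`, as a continuous map. -/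
noncomputable def precomp (g : C(X, Z)) : C(FunSpace Z Y, FunSpace X Y) where
  toFun := CompactCoherentification.map fun u : C(Z, Y) => u.comp g
  continuous_toFun :=
    CompactCoherentification.continuous_map_of_continuous (ContinuousMap.continuous_precomp g)

theorem precomp_of (g : C(X, Z)) (u : C(Z, Y)) : precomp g (of u) = of (u.comp g) := rfl

end FunSpace

/-! ### Functoriality of homotopy groups -/

namespace HomotopyGroup

variable {N : Type*} {A B D : Type*} [TopologicalSpace A] [TopologicalSpace B]
  [TopologicalSpace D] {a : A} {b : B} {d : D}

/-- Composition of a generalized loop with a based map. -/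
def pushLoop (g : C(A, B)) (hg : g a = b) (p : Ω^ N A a) : Ω^ N B b :=
  ⟨g.comp p.1, fun y hy => (congrArg g (p.2 y hy)).trans hg⟩

/-- The map on homotopy groups (homotopy sets in degree `0`) induced by a based map `g`. -/
def push (N : Type*) (g : C(A, B)) (hg : g a = b) : HomotopyGroup N A a → HomotopyGroup N B b :=
  Quotient.map (pushLoop g hg) fun _ _ ⟨H⟩ => ⟨H.compContinuousMap g⟩

theorem push_mk (g : C(A, B)) (hg : g a = b) (p : Ω^ N A a) :
    push N g hg (Quotient.mk _ p) = Quotient.mk _ (pushLoop g hg p) := rfl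

theorem push_id (g : C(A, A)) (hg : g a = a) (h : ∀ y, g y = y) (x : HomotopyGroup N A a) :
    push N g hg x = x := by
  induction x using Quotient.inductionOn with
  | _ p =>
    rw [push_mk]
    congr 1
    ext y
    exact h _

theorem push_push (g : C(A, B)) (hg : g a = b) (k : C(B, D)) (hk : k b = d) (l : C(A, D))
    (hl : l a = d) (h : ∀ y, k (g y) = l y) (x : HomotopyGroup N A a) :
    push N k hk (push N g hg x) = push N l hl x := by
  induction x using Quotient.inductionOn with
  | _ p =>
    simp only [push_mk]
    congr 1
    ext y
    exact h _

theorem push_mul [DecidableEq N] [Nonempty N] (g : C(A, B)) (hg : g a = b)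
    (x y : HomotopyGroup N A a) : push N g hg (x * y) = push N g hg x * push N g hg y := by
  induction x using Quotient.inductionOn with
  | _ p =>
    induction y using Quotient.inductionOn with
    | _ q =>
      have e1 := mul_spec (i := Classical.arbitrary N) (p := p) (q := q)
      have e2 := mul_spec (i := Classical.arbitrary N) (p := pushLoop g hg p)
        (q := pushLoop g hg q)
      refine (congrArg (push N g hg) e1).trans (Eq.trans ?_ e2.symm)
      rw [push_mk]
      congr 1
      ext t
      change g (GenLoop.transAt _ q p t) = GenLoop.transAt _ _ _ t
      simp only [GenLoop.transAt, GenLoop.coe_copy]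
      split_ifs <;> rfl

theorem push_default (g : C(A, B)) (hg : g a = b) :
    push N g hg (default : HomotopyGroup N A a) = default := by
  change push N g hg (Quotient.mk _ GenLoop.const) = Quotient.mk _ GenLoop.const
  rw [push_mk]
  congr 1
  ext y
  exact hg

/-- A map of based sets. -/
structure BasedMap (S T : Type*) [Inhabited S] [Inhabited T] where
  toFun : S → T
  map_default' : toFun default = default

instance {S T : Type*} [Inhabited S] [Inhabited T] : FunLike (BasedMap S T) S T where
  coe := BasedMap.toFun
  coe_injective f g h := by cases f; cases g; congr

/-- The map of based sets induced by a based map, in all degrees. The base point of a homotopy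
group or homotopy set is `default`, the class of the constant loop. -/
def pushBased (N : Type*) (g : C(A, B)) (hg : g a = b) :
    BasedMap (HomotopyGroup N A a) (HomotopyGroup N B b) :=
  ⟨push N g hg, push_default g hg⟩

/-- The group homomorphism induced by a based map in positive degrees. -/
noncomputable def pushHom (N : Type*) [DecidableEq N] [Nonempty N] (g : C(A, B)) (hg : g a = b) :
    HomotopyGroup N A a →* HomotopyGroup N B b :=
  MonoidHom.mk' (push N g hg) (push_mul g hg)

end HomotopyGroup

/-! ### Inverse systems of spaces

The spaces `X_j` of the system are written `K j`. -/

instance Set.Ici.instIsDirectedOrder {ι : Type*} [Preorder ι] [IsDirectedOrder ι] (m : ι) :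
    IsDirectedOrder (Set.Ici m) where
  directed i j :=
    let ⟨k, hik, hjk⟩ := exists_ge_ge i.1 j.1
    ⟨⟨k, le_trans i.2 hik⟩, hik, hjk⟩

section InverseSystem

variable {ι : Type*} [Preorder ι] {K : ι → Type*} [∀ j, TopologicalSpace (K j)]
  {X Y : Type*} [TopologicalSpace X] [TopologicalSpace Y]

/-- The inverse limit of a system of spaces, as a subspace of the product. -/
abbrev InvLimit (p : ∀ ⦃i j : ι⦄, i ≤ j → C(K j, K i)) : Type _ :=
  {x : ∀ j, K j // ∀ i j (hij : i ≤ j), p hij (x j) = x i}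

/-- The map into the inverse limit induced by a compatible family of maps. -/
def toInvLimit (p : ∀ ⦃i j : ι⦄, i ≤ j → C(K j, K i)) (h : ∀ j, C(X, K j))
    (hh : ∀ i j (hij : i ≤ j) (x : X), p hij (h j x) = h i x) (x : X) : InvLimit p :=
  ⟨fun j => h j x, fun i j hij => hh i j hij x⟩

/-- The maps `f_j = f_m ∘ p_{jm} : X_j → Y` for `j ≥ m`. -/
def stageMap (p : ∀ ⦃i j : ι⦄, i ≤ j → C(K j, K i)) (m : ι) (fm : C(K m, Y)) (j : Set.Ici m) :
    C(K j, Y) :=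
  fm.comp (p j.2)

/-- `π_n(F(X_j, Y); f_j)`, for `j ≥ m`. -/
abbrev StagePi (p : ∀ ⦃i j : ι⦄, i ≤ j → C(K j, K i)) (m : ι) (fm : C(K m, Y)) (n : ℕ)
    (j : Set.Ici m) : Type _ :=
  π_ n (FunSpace (K j) Y) (FunSpace.of (stageMap p m fm j))

variable (p : ∀ ⦃i j : ι⦄, i ≤ j → C(K j, K i)) (m : ι) (fm : C(K m, Y)) (n : ℕ)

theorem precomp_stage
    [hp : InverseSystem fun (i j : ι) (hij : i ≤ j) => (p hij : K j → K i)]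
    {i j : Set.Ici m} (hij : i ≤ j) :
    FunSpace.precomp (p hij) (FunSpace.of (stageMap p m fm i)) =
      FunSpace.of (stageMap p m fm j) := by
  rw [FunSpace.precomp_of]
  congr 1
  ext x
  exact congrArg fm (hp.map_map i.2 hij x)

/-- The transition map `p_{ji}^* : π_n(F(X_i, Y); f_i) → π_n(F(X_j, Y); f_j)` for `m ≤ i ≤ j`,
as a map of based sets. -/
noncomputable def stageTrans
    [InverseSystem fun (i j : ι) (hij : i ≤ j) => (p hij : K j → K i)]
    (i j : Set.Ici m) (hij : i ≤ j) :
    HomotopyGroup.BasedMap (StagePi p m fm n i) (StagePi p m fm n j) :=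
  HomotopyGroup.pushBased (Fin n) (FunSpace.precomp (p hij)) (precomp_stage p m fm hij)

/-- The transition map as a group homomorphism, in positive degrees. -/
noncomputable def stageTransHom
    [InverseSystem fun (i j : ι) (hij : i ≤ j) => (p hij : K j → K i)]
    (i j : Set.Ici m) (hij : i ≤ j) :
    StagePi p m fm (n + 1) i →* StagePi p m fm (n + 1) j :=
  HomotopyGroup.pushHom (Fin (n + 1)) (FunSpace.precomp (p hij)) (precomp_stage p m fm hij)

theorem precomp_refl
    [hp : InverseSystem fun (i j : ι) (hij : i ≤ j) => (p hij : K j → K i)]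
    (i : ι) (u : FunSpace (K i) Y) : FunSpace.precomp (p (le_refl i)) u = u :=
  ContinuousMap.ext (f := (FunSpace.precomp (p (le_refl i)) u : C(K i, Y))) (g := u)
    fun x => congrArg ((CompactCoherentification.mk C(K i, Y)).symm u) (hp.map_self x)

theorem precomp_trans
    [hp : InverseSystem fun (i j : ι) (hij : i ≤ j) => (p hij : K j → K i)]
    {k j i : ι} (hij : i ≤ j) (hjk : j ≤ k) (u : FunSpace (K i) Y) :
    FunSpace.precomp (p hjk) (FunSpace.precomp (p hij) u) =
      FunSpace.precomp (p (hij.trans hjk)) u :=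
  ContinuousMap.ext
    fun x => congrArg ((CompactCoherentification.mk C(K i, Y)).symm u) (hp.map_map hij hjk x)

instance stageTrans_directedSystem
    [InverseSystem fun (i j : ι) (hij : i ≤ j) => (p hij : K j → K i)] :
    DirectedSystem (StagePi p m fm n) (fun i j hij => stageTrans p m fm n i j hij) where
  map_self i x := HomotopyGroup.push_id _ _ (precomp_refl p i.1) x
  map_map _ _ _ hij hjk x := HomotopyGroup.push_push _ _ _ _ _ _
    (precomp_trans p (Y := Y) hij hjk) x

instance stageTransHom_directedSystem
    [InverseSystem fun (i j : ι) (hij : i ≤ j) => (p hij : K j → K i)] :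
    DirectedSystem (StagePi p m fm (n + 1)) (fun i j hij => stageTransHom p m fm n i j hij) :=
  stageTrans_directedSystem p m fm (n + 1)

theorem precomp_limit (h : ∀ j, C(X, K j))
    (hh : ∀ i j (hij : i ≤ j) (x : X), p hij (h j x) = h i x) (j : Set.Ici m) :
    FunSpace.precomp (h j) (FunSpace.of (stageMap p m fm j)) = FunSpace.of (fm.comp (h m)) := by
  rw [FunSpace.precomp_of]
  congr 1
  ext x
  exact congrArg fm (hh m j j.2 x)

/-- The map `h_j^* : π_n(F(X_j, Y); f_j) → π_n(F(X, Y); f)`, where `f = f_m ∘ h_m`. -/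
noncomputable def stageToLimit (h : ∀ j, C(X, K j))
    (hh : ∀ i j (hij : i ≤ j) (x : X), p hij (h j x) = h i x) (j : Set.Ici m) :
    StagePi p m fm n j → π_ n (FunSpace X Y) (FunSpace.of (fm.comp (h m))) :=
  HomotopyGroup.push (Fin n) (FunSpace.precomp (h j)) (precomp_limit p m fm h hh j)

end InverseSystem

/-! ### Homotopy extension for cubes -/

namespace Cube

/-! By adjunction, an element of `π_n(F(X,Y); f)` is a map `I^n × X → Y` that restricts to `f` on
the boundary of the cube, up to homotopy relative to that boundary. The theorem thus says that such
maps, and the homotopies between them, come up to homotopy from a finite stage, with the boundary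
values kept exact.

A compact subset of `Y` lies in a finite union of cells `L`. Although `L` need not be embedded in a
Euclidean space, its inclusion factors up to homotopy as `L → O → Y`, with `O` open in a
finite-dimensional normed space (`IsOpenDominated`); this is proved by attaching one cell at a time.
Maps into `O` can be approximated linearly. By Stone–Weierstrass, functions on `T × X` coming from
stages are dense. A cutoff function makes the approximation exact on a closed set of parameters, and
compactness of the stages forces the values on a whole later stage into `O`
(`InvLimit.exists_stage_map`). For surjectivity the straight segment from the given map to the
approximation stays in `O`; for injectivity the approximation is itself the homotopy sought.

Returning to `Y` replaces the boundary value `f` by a homotopic one. The track of that homotopy is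
undone by homotopy extension for cubes (`Cube.exists_homotopicAlong`,
`Cube.HomotopicAlong.transport`). The two halves are `InvLimit.exists_stage_homotopicAlong` and
`InvLimit.exists_stage_homotopicAlong_of_homotopicAlong`. -/

theorem isClosed_boundary (N : Type*) [Finite N] : IsClosed (Cube.boundary N) := by
  have : Cube.boundary N = ⋃ i, {y : I^N | y i = 0 ∨ y i = 1} := by
    ext y; simp [Cube.boundary]
  rw [this]
  refine isClosed_iUnion_of_finite fun i => ?_
  exact (isClosed_eq (continuous_apply i) continuous_const).union
    (isClosed_eq (continuous_apply i) continuous_const)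

/-- The cube `I × I^n` retracts onto the union of its bottom face and its sides. -/
theorem exists_retraction (n : ℕ) : ∃ ρ : C(I × (Fin n → I), I × (Fin n → I)),
    (∀ z, (ρ z).1 = 0 ∨ (ρ z).2 ∈ Cube.boundary (Fin n)) ∧
    ∀ z, (z.1 = 0 ∨ z.2 ∈ Cube.boundary (Fin n)) → ρ z = z := by
  let c : (Fin n → I) → (Fin n → ℝ) := fun t i => 2 * (t i : ℝ) - 1
  have hc : Continuous c := by fun_prop
  have hc1 : ∀ t, ‖c t‖ ≤ 1 := fun t => by
    refine (pi_norm_le_iff_of_nonneg zero_le_one).2 fun i => ?_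
    rw [Real.norm_eq_abs, abs_le]
    constructor <;> linarith [(t i).2.1, (t i).2.2]
  -- Radial projection from the point at height 2 above the centre of the cube. In centred
  -- coordinates, dividing by `μ` rescales about that point until the height is 0 or the sup norm is
  -- 1. The results already lie in the cube, so `projIcc` only adjusts types.
  let μ : I × (Fin n → I) → ℝ := fun z => max ‖c z.2‖ (1 - (z.1 : ℝ) / 2)
  have hμ : Continuous μ := by fun_prop
  have hμ0 : ∀ z, 0 < μ z := fun z => lt_max_of_lt_right (by linarith [z.1.2.2])
  have hμ1 : ∀ z, (z.1 = 0 ∨ z.2 ∈ Cube.boundary (Fin n)) → μ z = 1 := by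
    rintro ⟨s, t⟩ (h | ⟨i, h⟩)
    · simp only at h
      simp only [μ, h]
      simpa using hc1 t
    · have : ‖c t‖ = 1 := by
        refine le_antisymm (hc1 t) ?_
        refine le_trans ?_ (norm_le_pi_norm (c t) i)
        rcases h with h | h <;> simp only at h <;> norm_num [c, h]
      simp only [μ, this]
      exact max_eq_left (by linarith [s.2.1])
  refine ⟨⟨fun z => (projIcc 0 1 zero_le_one (2 - (2 - (z.1 : ℝ)) / μ z),
    fun i => projIcc 0 1 zero_le_one ((c z.2 i / μ z + 1) / 2)), ?_⟩, ?_, ?_⟩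
  · refine Continuous.prodMk (continuous_projIcc.comp ?_)
      (continuous_pi fun i => continuous_projIcc.comp ?_)
    · exact continuous_const.sub ((by fun_prop : Continuous fun z : I × (Fin n → I) =>
        2 - (z.1 : ℝ)).div hμ fun z => (hμ0 z).ne')
    · exact ((((continuous_apply i).comp (hc.comp continuous_snd)).div hμ
        fun z => (hμ0 z).ne').add continuous_const).div_const _
  · rintro ⟨s, t⟩
    rcases le_total ‖c t‖ (1 - (s : ℝ) / 2) with h | h
    · left
      have e : μ (s, t) = 1 - (s : ℝ) / 2 := max_eq_right h
      have h0 := hμ0 (s, t)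
      change projIcc 0 1 zero_le_one _ = _
      rw [e] at h0 ⊢
      have : (2 - (s : ℝ)) / (1 - (s : ℝ) / 2) = 2 := by
        rw [div_eq_iff h0.ne']; ring
      simp only [this]
      norm_num
    · right
      have e : μ (s, t) = ‖c t‖ := max_eq_left h
      have h0 := hμ0 (s, t)
      rw [e] at h0
      have hne : (Finset.univ : Finset (Fin n)).Nonempty := by
        by_contra hcon
        rw [Finset.not_nonempty_iff_eq_empty] at hcon
        rw [Pi.norm_def, hcon] at h0
        simp at h0
      obtain ⟨i, -, hi⟩ := Finset.exists_mem_eq_sup _ hne fun i => ‖c t i‖₊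
      have hi' : ‖c t‖ = |c t i| := by
        rw [Pi.norm_def, hi]; rfl
      refine ⟨i, ?_⟩
      change projIcc 0 1 zero_le_one _ = _ ∨ projIcc 0 1 zero_le_one _ = _
      rw [e]
      rcases abs_choice (c t i) with h' | h'
      · right
        have : c t i / ‖c t‖ = 1 := by rw [div_eq_one_iff_eq h0.ne', hi', h']
        simp only [this]
        norm_num
      · left
        have : c t i / ‖c t‖ = -1 := by
          rw [div_eq_iff h0.ne', hi', h']; ring
        simp only [this]
        norm_num
  · rintro ⟨s, t⟩ h
    have e := hμ1 _ h
    refine Prod.ext ?_ (funext fun i => ?_)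
    · change projIcc 0 1 zero_le_one _ = s
      rw [e]
      have : 2 - (2 - (s : ℝ)) / 1 = s := by ring
      simp only [this]
      exact projIcc_val zero_le_one s
    · change projIcc 0 1 zero_le_one _ = t i
      rw [e]
      have : (c t i / 1 + 1) / 2 = t i := by simp only [c]; ring
      simp only [this]
      exact projIcc_val zero_le_one (t i)

/-! ### Homotopy extension and change of boundary values. -/

variable {n : ℕ} {T S Y : Type*} [TopologicalSpace T] [TopologicalSpace S] [TopologicalSpace Y]

/-- A map that is continuous on the bottom face and the sides of `I × I^n` (times a parameter
space) extends to the whole product. -/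
theorem exists_extension (g : I × (Fin n → I) × T → Y)
    (hg : ContinuousOn g {z | z.1 = 0 ∨ z.2.1 ∈ Cube.boundary (Fin n)}) :
    ∃ G : C(I × (Fin n → I) × T, Y),
      ∀ z, (z.1 = 0 ∨ z.2.1 ∈ Cube.boundary (Fin n)) → G z = g z := by
  obtain ⟨ρ, h1, h2⟩ := exists_retraction n
  refine ⟨⟨fun z => g ((ρ (z.1, z.2.1)).1, (ρ (z.1, z.2.1)).2, z.2.2), ?_⟩, ?_⟩
  · exact hg.comp_continuous (by fun_prop) fun z => h1 _
  · rintro ⟨s, t, x⟩ h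
    change g _ = _
    rw [h2 (s, t) h]

/-- Two families of maps of cubes, parametrized by `T`, are homotopic along `γ` if there is a
homotopy between them which at time `s` takes the value `γ (s, x)` on the boundary of the cube. -/
def HomotopicAlong (γ : C(I × T, Y)) (p q : C((Fin n → I) × T, Y)) : Prop :=
  ∃ K : C(I × (Fin n → I) × T, Y), (∀ z, K (0, z) = p z) ∧ (∀ z, K (1, z) = q z) ∧
    ∀ s, ∀ t ∈ Cube.boundary (Fin n), ∀ x, K (s, t, x) = γ (s, x)

/-- The constant path at `f`. -/
def constPath (f : C(T, Y)) : C(I × T, Y) := f.comp .snd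

theorem HomotopicAlong.precomp {γ : C(I × T, Y)} {p q : C((Fin n → I) × T, Y)}
    (H : HomotopicAlong γ p q) (h : C(S, T)) :
    HomotopicAlong (γ.comp ((ContinuousMap.id _).prodMap h))
      (p.comp ((ContinuousMap.id _).prodMap h)) (q.comp ((ContinuousMap.id _).prodMap h)) := by
  obtain ⟨K, h0, h1, h2⟩ := H
  exact ⟨K.comp ((ContinuousMap.id _).prodMap ((ContinuousMap.id _).prodMap h)),
    fun z => h0 _, fun z => h1 _, fun s t ht x => h2 s t ht _⟩

/-- Homotopy extension for the pair of the cube and its boundary, with parameters: `p` on the floor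
and `γ` on the sides extend over `I × I^n`, and `q` is read off at the top. -/
theorem exists_homotopicAlong (γ : C(I × T, Y)) (p : C((Fin n → I) × T, Y))
    (hp : ∀ t ∈ Cube.boundary (Fin n), ∀ x, p (t, x) = γ (0, x)) :
    ∃ q, HomotopicAlong γ p q := by
  classical
  let g : I × (Fin n → I) × T → Y := fun z => if z.1 = 0 then p z.2 else γ (z.1, z.2.2)
  have e0 : EqOn g (fun z => p z.2) {z | z.1 = 0} := fun z hz => if_pos hz
  have e1 : EqOn g (fun z => γ (z.1, z.2.2)) {z | z.2.1 ∈ Cube.boundary (Fin n)} := by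
    rintro ⟨s, t, x⟩ ht
    by_cases hs : s = 0
    · subst hs
      exact (if_pos rfl).trans (hp t ht x)
    · exact if_neg hs
  have hg : ContinuousOn g {z | z.1 = 0 ∨ z.2.1 ∈ Cube.boundary (Fin n)} := by
    refine ContinuousOn.union_of_isClosed (ContinuousOn.congr ?_ e0) (ContinuousOn.congr ?_ e1)
      (isClosed_eq continuous_fst continuous_const)
      ((isClosed_boundary _).preimage (by fun_prop))
    · fun_prop
    · fun_prop
  obtain ⟨K, hK⟩ := exists_extension g hg
  refine ⟨K.comp ⟨fun z => (1, z), by fun_prop⟩, K, fun z => ?_, fun z => rfl, fun s t ht x => ?_⟩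
  · rw [hK _ (Or.inl rfl)]; exact e0 rfl
  · rw [hK _ (Or.inr ht)]; exact e1 ht

/-- Fill a box of one dimension more, whose first cube coordinate is the time of the homotopy `D`.
The floor carries `D`, the two walls across that coordinate carry `K` and `K'`, and the other walls
carry `γ`. The lid of the filling is the required homotopy. -/
theorem HomotopicAlong.transport {γ : C(I × T, Y)} {f₀ f₁ : C(T, Y)}
    (hγ₀ : ∀ x, γ (0, x) = f₀ x) (hγ₁ : ∀ x, γ (1, x) = f₁ x)
    {p q p' q' : C((Fin n → I) × T, Y)} (H : HomotopicAlong γ p q) (H' : HomotopicAlong γ p' q')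
    (D : HomotopicAlong (constPath f₀) p p') : HomotopicAlong (constPath f₁) q q' := by
  classical
  obtain ⟨K, hK0, hK1, hK⟩ := H
  obtain ⟨K', hK0', hK1', hK'⟩ := H'
  obtain ⟨D, hD0, hD1, hD⟩ := D
  let g : I × (Fin (n + 1) → I) × T → Y := fun z =>
    if z.2.1 0 = 0 then K (z.1, Fin.tail z.2.1, z.2.2)
    else if z.2.1 0 = 1 then K' (z.1, Fin.tail z.2.1, z.2.2)
    else if z.1 = 0 then D (z.2.1 0, Fin.tail z.2.1, z.2.2)
    else γ (z.1, z.2.2)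
  have htail : Continuous (Fin.tail : (Fin (n + 1) → I) → Fin n → I) :=
    continuous_pi fun i => continuous_apply _
  have e1 : EqOn g (fun z => K (z.1, Fin.tail z.2.1, z.2.2)) {z | z.2.1 0 = 0} :=
    fun z hz => if_pos hz
  have e2 : EqOn g (fun z => K' (z.1, Fin.tail z.2.1, z.2.2)) {z | z.2.1 0 = 1} := by
    intro z hz
    have hz' : z.2.1 0 = 1 := hz
    have : z.2.1 0 ≠ 0 := by rw [hz']; exact one_ne_zero
    simp only [g, if_neg this, if_pos hz']
  have e3 : EqOn g (fun z => D (z.2.1 0, Fin.tail z.2.1, z.2.2)) {z | z.1 = 0} := by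
    rintro ⟨s, t, x⟩ (rfl : s = 0)
    simp only [g, if_true]
    split_ifs with h1 h2
    · rw [h1, hK0, hD0]
    · rw [h2, hK0', hD1]
    · rfl
  have e4 : EqOn g (fun z => γ (z.1, z.2.2)) {z | Fin.tail z.2.1 ∈ Cube.boundary (Fin n)} := by
    rintro ⟨s, t, x⟩ ht
    simp only [g]
    split_ifs with h1 h2 h3
    · exact hK _ _ ht _
    · exact hK' _ _ ht _
    · rw [hD _ _ ht, h3, hγ₀]; rfl
    · rfl
  have hg : ContinuousOn g {z | z.1 = 0 ∨ z.2.1 ∈ Cube.boundary (Fin (n + 1))} := by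
    have hc : IsClosed {z : I × (Fin (n + 1) → I) × T | z.1 = 0} :=
      isClosed_eq continuous_fst continuous_const
    have hc0 : IsClosed {z : I × (Fin (n + 1) → I) × T | z.2.1 0 = 0} :=
      isClosed_eq (by fun_prop) continuous_const
    have hc1 : IsClosed {z : I × (Fin (n + 1) → I) × T | z.2.1 0 = 1} :=
      isClosed_eq (by fun_prop) continuous_const
    have hcb : IsClosed {z : I × (Fin (n + 1) → I) × T |
        Fin.tail z.2.1 ∈ Cube.boundary (Fin n)} :=
      (isClosed_boundary _).preimage (by fun_prop)
    refine ContinuousOn.mono (((ContinuousOn.congr ?_ e3).union_of_isClosed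
      (ContinuousOn.congr ?_ e1) hc hc0).union_of_isClosed
      ((ContinuousOn.congr ?_ e2).union_of_isClosed (ContinuousOn.congr ?_ e4) hc1 hcb)
      (hc.union hc0) (hc1.union hcb)) ?_
    · fun_prop
    · fun_prop
    · fun_prop
    · fun_prop
    · rintro ⟨s, t, x⟩ (h | ⟨i, h⟩)
      · exact Or.inl (Or.inl h)
      · induction i using Fin.cases with
        | zero => exact h.elim (fun h => Or.inl (Or.inr h)) fun h => Or.inr (Or.inl h)
        | succ i => exact Or.inr (Or.inr ⟨i, h⟩)
  obtain ⟨G, hG⟩ := exists_extension g hg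
  have hcons : Continuous fun z : I × (Fin n → I) × T =>
      ((1 : I), (Fin.cons z.1 z.2.1 : Fin (n + 1) → I), z.2.2) := by
    refine continuous_const.prodMk (Continuous.prodMk (continuous_pi fun i => ?_) (by fun_prop))
    induction i using Fin.cases with
    | zero => simpa using continuous_fst
    | succ i => simp only [Fin.cons_succ]; fun_prop
  refine ⟨G.comp ⟨_, hcons⟩, fun z => ?_, fun z => ?_, fun s t ht x => ?_⟩
  · refine (hG _ (Or.inr ⟨0, Or.inl rfl⟩)).trans ((e1 rfl).trans ?_)
    simpa using hK1 z
  · refine (hG _ (Or.inr ⟨0, Or.inr rfl⟩)).trans ((e2 rfl).trans ?_)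
    simpa using hK1' z
  · obtain ⟨i, hi⟩ := ht
    refine (hG _ (Or.inr ⟨i.succ, by simpa using hi⟩)).trans ((e4 ?_).trans (hγ₁ x))
    exact ⟨i, by simpa using hi⟩

end Cube

/-! ### Attaching a cell, and domination by open sets of normed spaces -/

section Glue

variable {Y T V P : Type*} [TopologicalSpace Y] [TopologicalSpace T] [TopologicalSpace V]
  [TopologicalSpace P]

/-- A continuous map from a compact set to a Hausdorff space is closed, hence a quotient map onto
its image. -/
theorem IsCompact.continuousOn_image_of_comp [T2Space Y] {D : Set V} (hD : IsCompact D) {Φ : V → Y}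
    (hΦ : ContinuousOn Φ D) {b : Y → T} (hb : ContinuousOn (b ∘ Φ) D) :
    ContinuousOn b (Φ '' D) := by
  refine continuousOn_iff_isClosed.2 fun C hC => ?_
  obtain ⟨u, hu, hu'⟩ := continuousOn_iff_isClosed.1 hb C hC
  refine ⟨Φ '' (D ∩ u), ((hD.inter_right hu).image_of_continuousOn
    (hΦ.mono inter_subset_left)).isClosed, ?_⟩
  ext y
  constructor
  · rintro ⟨hy, v, hv, rfl⟩
    have : v ∈ u ∩ D := hu' ▸ ⟨hy, hv⟩
    exact ⟨⟨v, ⟨hv, this.1⟩, rfl⟩, mem_image_of_mem _ hv⟩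
  · rintro ⟨⟨v, ⟨hv, hvu⟩, rfl⟩, h2⟩
    have : v ∈ (b ∘ Φ) ⁻¹' C ∩ D := hu' ▸ ⟨hvu, hv⟩
    exact ⟨this.1, h2⟩

/-- `L` is obtained from the closed set `L₀` by attaching the unit ball of a normed space along
the map `Φ`. -/
structure IsCellAttachment {V : Type*} [NormedAddCommGroup V] (L₀ : Set Y) (Φ : V → Y) : Prop where
  isClosed : IsClosed L₀
  continuousOn : ContinuousOn Φ (Metric.closedBall 0 1)
  mapsTo_sphere : MapsTo Φ (Metric.sphere 0 1) L₀
  injOn : InjOn Φ (Metric.ball 0 1)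
  notMem : ∀ v ∈ Metric.ball (0 : V) 1, Φ v ∉ L₀

/-- The universal property of the attachment. The parameter space `P` allows homotopies to be glued;
its compactness keeps the product with the ball compact. -/
theorem IsCellAttachment.exists_glue [T2Space Y] [CompactSpace P] [T2Space P]
    {V : Type*} [NormedAddCommGroup V] [ProperSpace V]
    {L₀ : Set Y} {Φ : V → Y} (h : IsCellAttachment L₀ Φ) (a : P × Y → T) (B : P × V → T)
    (ha : ContinuousOn a (univ ×ˢ L₀)) (hB : ContinuousOn B (univ ×ˢ Metric.closedBall 0 1))
    (hab : ∀ s, ∀ v ∈ Metric.sphere (0 : V) 1, B (s, v) = a (s, Φ v)) :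
    ∃ b : P × Y → T, ContinuousOn b (univ ×ˢ (L₀ ∪ Φ '' Metric.closedBall 0 1)) ∧
      (∀ s, ∀ y ∈ L₀, b (s, y) = a (s, y)) ∧
      ∀ s, ∀ v ∈ Metric.closedBall (0 : V) 1, b (s, Φ v) = B (s, v) := by
  classical
  let b : P × Y → T := fun z =>
    if z.2 ∈ L₀ then a z else B (z.1, Function.invFunOn Φ (Metric.ball 0 1) z.2)
  have h1 : ∀ s, ∀ y ∈ L₀, b (s, y) = a (s, y) := fun s y hy => if_pos hy
  have h2 : ∀ s, ∀ v ∈ Metric.closedBall (0 : V) 1, b (s, Φ v) = B (s, v) := by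
    intro s v hv
    rw [← Metric.sphere_union_ball] at hv
    rcases hv with hv | hv
    · rw [h1 _ _ (h.mapsTo_sphere hv), hab s v hv]
    · have : b (s, Φ v) = B (s, Function.invFunOn Φ (Metric.ball 0 1) (Φ v)) :=
        if_neg (h.notMem v hv)
      rw [this, h.injOn.leftInvOn_invFunOn hv]
  refine ⟨b, ?_, h1, h2⟩
  rw [prod_union]
  have himg : (univ : Set P) ×ˢ (Φ '' Metric.closedBall 0 1) =
      Prod.map id Φ '' (univ ×ˢ Metric.closedBall 0 1) := by
    rw [Set.prodMap_image_prod, image_id]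
  have hcpt : IsCompact ((univ : Set P) ×ˢ Metric.closedBall (0 : V) 1) :=
    isCompact_univ.prod (isCompact_closedBall _ _)
  have hc : ContinuousOn (Prod.map id Φ) ((univ : Set P) ×ˢ Metric.closedBall (0 : V) 1) :=
    continuousOn_id.prodMap h.continuousOn
  refine ContinuousOn.union_of_isClosed (ha.congr fun z hz => h1 z.1 z.2 hz.2) ?_
    (isClosed_univ.prod h.isClosed) ?_
  · rw [himg]
    exact hcpt.continuousOn_image_of_comp hc (hB.congr fun z hz => h2 z.1 z.2 hz.2)
  · rw [himg]
    exact (hcpt.image_of_continuousOn hc).isClosed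

end Glue

/-- A subset `L` of a space is dominated by an open set if its inclusion factors up to homotopy
through an open subset of a finite-dimensional normed space. -/
def IsOpenDominated {Y : Type*} [TopologicalSpace Y] (L : Set Y) : Prop :=
  ∃ (E : Type) (_ : NormedAddCommGroup E) (_ : NormedSpace ℝ E) (_ : FiniteDimensional ℝ E)
    (O : Set E) (i : Y → E) (r : E → Y) (H : I × Y → Y), IsOpen O ∧ ContinuousOn i L ∧
    MapsTo i L O ∧ ContinuousOn r O ∧ ContinuousOn H (univ ×ˢ L) ∧
    (∀ y ∈ L, H (0, y) = r (i y)) ∧ ∀ y ∈ L, H (1, y) = y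

namespace IsOpenDominated

variable {Y : Type*} [TopologicalSpace Y]

theorem mono {L L' : Set Y} (h : IsOpenDominated L) (hL : L' ⊆ L) : IsOpenDominated L' := by
  obtain ⟨E, _, _, _, O, i, r, H, hO, hi, hiO, hr, hH, h0, h1⟩ := h
  exact ⟨E, _, _, ‹_›, O, i, r, H, hO, hi.mono hL, hiO.mono_left hL, hr,
    hH.mono (prod_mono_right hL), fun y hy => h0 y (hL hy), fun y hy => h1 y (hL hy)⟩

theorem empty [Nonempty Y] : IsOpenDominated (∅ : Set Y) :=
  ⟨ℝ, inferInstance, inferInstance, inferInstance, ∅, fun _ => 0,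
    fun _ => Classical.arbitrary Y, fun z => z.2, isOpen_empty, continuousOn_empty _,
    mapsTo_empty _ _, continuousOn_empty _, by simp, by simp, by simp⟩

end IsOpenDominated

/-! ### Domination is preserved by attaching a cell. -/

section Cone

variable {Y V : Type*} [NormedAddCommGroup V] [NormedSpace ℝ V]

/-- The cone coordinate on an attached cell: it follows the homotopy `H` at the boundary of the
cell and then the radius inwards. -/
noncomputable def coneMap (Φ : V → Y) (H : I × Y → Y) (z : V × ℝ) : Y :=
  if z.2 ≤ 1 then H (projIcc 0 1 zero_le_one z.2, Φ z.1) else Φ (max (2 - z.2) 0 • z.1)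

variable {Φ : V → Y} {H : I × Y → Y}

theorem coneMap_of_le_zero {u : V} {τ : ℝ} (h : τ ≤ 0) : coneMap Φ H (u, τ) = H (0, Φ u) := by
  have h1 : τ ≤ 1 := h.trans zero_le_one
  simp only [coneMap, h1, if_true]
  rw [projIcc_of_le_left _ h]; rfl

theorem coneMap_of_le_one {u : V} {τ : ℝ} (h : τ ≤ 1) :
    coneMap Φ H (u, τ) = H (projIcc 0 1 zero_le_one τ, Φ u) := if_pos h

theorem coneMap_of_one_le {u : V} {τ : ℝ} (h : 1 ≤ τ) (hu : H (1, Φ u) = Φ u) :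
    coneMap Φ H (u, τ) = Φ (max (2 - τ) 0 • u) := by
  rcases h.eq_or_lt with rfl | h
  · rw [coneMap_of_le_one le_rfl, projIcc_right]
    refine Eq.trans hu ?_
    norm_num
  · exact if_neg h.not_ge

end Cone

section Attach

variable {Y V : Type*} [TopologicalSpace Y] [NormedAddCommGroup V] [NormedSpace ℝ V]

/-- The radial projection to the unit sphere. -/
noncomputable def radial (v : V) : V := ‖v‖⁻¹ • v

theorem continuousOn_radial : ContinuousOn (radial : V → V) {v | v ≠ 0} :=
  (continuous_norm.continuousOn.inv₀ fun _ hv => norm_ne_zero_iff.2 hv).smul continuousOn_id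

theorem norm_radial {v : V} (hv : v ≠ 0) : ‖radial v‖ = 1 := by
  rw [radial, norm_smul, norm_inv, norm_norm, inv_mul_cancel₀ (norm_ne_zero_iff.2 hv)]

theorem radial_mem_sphere {v : V} (hv : v ≠ 0) : radial v ∈ Metric.sphere (0 : V) 1 := by
  simpa using norm_radial hv

theorem norm_smul_radial (v : V) : ‖v‖ • radial v = v := by
  rcases eq_or_ne v 0 with rfl | hv
  · simp [radial]
  · rw [radial, smul_smul, mul_inv_cancel₀ (norm_ne_zero_iff.2 hv), one_smul]

theorem radial_smul {c : ℝ} (hc : 0 < c) (v : V) : radial (c • v) = radial v := by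
  rw [radial, norm_smul, Real.norm_of_nonneg hc.le, mul_inv, smul_smul, radial]
  congr 1
  field_simp

theorem radial_of_norm_eq_one {v : V} (hv : ‖v‖ = 1) : radial v = v := by
  rw [radial, hv]; simp

variable {Φ : V → Y} {H : I × Y → Y} {L₀ : Set Y}

theorem continuousOn_coneMap (h : IsCellAttachment L₀ Φ) (hH : ContinuousOn H (univ ×ˢ L₀))
    (hH1 : ∀ y ∈ L₀, H (1, y) = y) :
    ContinuousOn (coneMap Φ H) (Metric.sphere (0 : V) 1 ×ˢ univ) := by
  have e : (Metric.sphere (0 : V) 1 ×ˢ univ : Set (V × ℝ)) =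
      (Metric.sphere (0 : V) 1 ×ˢ Iic 1) ∪ (Metric.sphere (0 : V) 1 ×ˢ Ici 1) := by
    rw [← prod_union, Iic_union_Ici]
  rw [e]
  refine ContinuousOn.union_of_isClosed ?_ ?_ (Metric.isClosed_sphere.prod isClosed_Iic)
    (Metric.isClosed_sphere.prod isClosed_Ici)
  · have : ContinuousOn (fun z : V × ℝ => H (projIcc 0 1 zero_le_one z.2, Φ z.1))
        (Metric.sphere (0 : V) 1 ×ˢ Iic 1) := by
      refine hH.comp (ContinuousOn.prodMk ?_ ?_) ?_
      · exact (continuous_projIcc.comp continuous_snd).continuousOn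
      · exact (h.continuousOn.mono Metric.sphere_subset_closedBall).comp continuousOn_fst
          fun z hz => hz.1
      · exact fun z hz => ⟨trivial, h.mapsTo_sphere hz.1⟩
    exact this.congr fun z hz => if_pos hz.2
  · have : ContinuousOn (fun z : V × ℝ => Φ (max (2 - z.2) 0 • z.1))
        (Metric.sphere (0 : V) 1 ×ˢ Ici 1) := by
      refine h.continuousOn.comp (by fun_prop) fun z hz => ?_
      have h1 : ‖z.1‖ = 1 := by simpa using hz.1
      have h2 : (1 : ℝ) ≤ z.2 := hz.2
      rw [mem_closedBall_zero_iff, norm_smul, h1, mul_one, Real.norm_of_nonneg (le_max_right _ _)]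
      exact max_le (by linarith) zero_le_one
    exact this.congr fun z hz => coneMap_of_one_le hz.2 (hH1 _ (h.mapsTo_sphere hz.1))

end Attach

section Attach

variable {Y : Type*} [TopologicalSpace Y]

/-- Attaching a cell preserves domination by open subsets of normed spaces. -/
theorem IsOpenDominated.attach [T2Space Y] {V : Type} [NormedAddCommGroup V] [NormedSpace ℝ V]
    [FiniteDimensional ℝ V] {L₀ : Set Y} {Φ : V → Y} (h : IsCellAttachment L₀ Φ)
    (hL₀ : IsOpenDominated L₀) : IsOpenDominated (L₀ ∪ Φ '' Metric.closedBall 0 1) := by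
  have hproper : ProperSpace V := FiniteDimensional.proper ℝ V
  obtain ⟨E, _, _, _, O₀, i₀, r₀, H₀, hO₀, hi₀, hiO₀, hr₀, hH₀, hH0, hH1⟩ := hL₀
  have hΦS : ContinuousOn Φ (Metric.sphere 0 1) :=
    h.continuousOn.mono Metric.sphere_subset_closedBall
  have hiΦ : ContinuousOn (i₀ ∘ Φ) (Metric.sphere 0 1) := hi₀.comp hΦS h.mapsTo_sphere
  -- With this `η`, a point within `η` of some `i₀ (Φ u)`, `‖u‖ = 1`, can be moved to it along a
  -- segment inside `O₀`.
  obtain ⟨η, hη, hηO⟩ := ((isCompact_sphere (0 : V) 1).image_of_continuousOn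
    hiΦ).exists_thickening_subset_open hO₀ (by
      rintro _ ⟨v, hv, rfl⟩
      exact hiO₀ (h.mapsTo_sphere hv))
  let ψ : V → E := fun v => i₀ (Φ (radial v))
  have hψ : ContinuousOn ψ {v | v ≠ 0} :=
    hiΦ.comp continuousOn_radial fun v hv => radial_mem_sphere hv
  have hball : ∀ v : V, v ≠ 0 → Metric.ball (ψ v) η ⊆ O₀ := fun v hv x hx =>
    hηO (Metric.mem_thickening_iff.2 ⟨_, ⟨_, radial_mem_sphere hv, rfl⟩, hx⟩)
  let cl : ℝ → ℝ := fun x => projIcc (0 : ℝ) 1 zero_le_one x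
  have hcl : Continuous cl := continuous_subtype_val.comp continuous_projIcc
  have hcl0 : ∀ x ≤ 0, cl x = 0 := fun x hx => by simp only [cl, projIcc_of_le_left _ hx]
  have hcl1 : ∀ x, 1 ≤ x → cl x = 1 := fun x hx => by simp only [cl, projIcc_of_right_le _ hx]
  have hclI : ∀ x, 0 ≤ cl x ∧ cl x ≤ 1 := fun x => (projIcc (0 : ℝ) 1 zero_le_one x).2
  have hnn : ∀ v : V, v ∈ Metric.closedBall (0 : V) 1 → ‖v‖ ≤ 1 := fun v hv => by simpa using hv
  have hcone := continuousOn_coneMap h hH₀ hH1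
  -- the map to the normed space
  let B : V → E × V × ℝ := fun v => (cl (4 * ‖v‖ - 2) • ψ v, (1 - ‖v‖) • v, 20 * (1 - ‖v‖))
  -- The coordinates of `B` record the boundary point, the direction and the depth. The first is cut
  -- off to 0 for `‖v‖ ≤ 1/2`, as `ψ` has no limit at 0 in general; it equals `ψ v` once `‖v‖ ≥
  -- 3/4`. On the sphere `B` is `(i₀ (Φ v), 0, 0)`, which matches `L₀`.
  have hB : ContinuousOn B (Metric.closedBall 0 1) := by
    refine ContinuousOn.prodMk ?_ (by fun_prop)
    have e : Metric.closedBall (0 : V) 1 ⊆ {v : V | ‖v‖ ≤ 1 / 2} ∪ {v : V | 1 / 2 ≤ ‖v‖} :=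
      fun v _ => le_total ‖v‖ (1 / 2)
    refine ContinuousOn.mono (ContinuousOn.union_of_isClosed ?_ ?_
      (isClosed_le continuous_norm continuous_const)
      (isClosed_le continuous_const continuous_norm)) e
    · refine (continuousOn_const (c := (0 : E))).congr fun v hv => ?_
      have hv : ‖v‖ ≤ 1 / 2 := hv
      simp only [hcl0 (4 * ‖v‖ - 2) (by linarith), zero_smul]
    · refine (hcl.comp (by fun_prop)).continuousOn.smul (hψ.mono fun v hv => ?_)
      have hv : 1 / 2 ≤ ‖v‖ := hv
      exact norm_pos_iff.1 (by linarith)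
  obtain ⟨bi, hbi, hbi1, hbi2⟩ := h.exists_glue (P := Unit) (fun z => (i₀ z.2, (0 : V), (0 : ℝ)))
    (fun z => B z.2)
    ((hi₀.comp continuousOn_snd fun z hz => hz.2).prodMk continuousOn_const)
    (hB.comp continuousOn_snd fun z hz => hz.2) (by
      intro s v hv
      have hv : ‖v‖ = 1 := by simpa using hv
      simp only [B, hv, ψ, radial_of_norm_eq_one hv, hcl1 (4 * 1 - 2) (by norm_num)]
      simp)
  -- the homotopy
  obtain ⟨bH, hbH, hbH1, hbH2⟩ := h.exists_glue (P := I)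
    (fun z => H₀ (projIcc 0 1 zero_le_one (3 * (z.1 : ℝ) - 2), z.2))
    (fun z => coneMap Φ H₀ (radial z.2,
      -- The cone time is interpolated linearly. At `s = 0` it is the depth shifted by 2, `20 * (1 -
      -- ‖v‖) - 2`, truncated at the centre time 2; at `s = 1` it is `2 - ‖v‖`, which gives back `Φ
      -- v`. On the sphere it is `3s - 2`, whence the formula on `L₀`.
      (1 - (z.1 : ℝ)) * min (18 - 20 * ‖z.2‖) 2 + z.1 * (2 - ‖z.2‖)))
    (hH₀.comp (ContinuousOn.prodMk (continuous_projIcc.comp (by fun_prop)).continuousOn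
      continuousOn_snd) fun z hz => ⟨trivial, hz.2⟩)
    (by
      have e : (univ ×ˢ Metric.closedBall (0 : V) 1 : Set (I × V)) ⊆
          {z | ‖z.2‖ ≤ 3 / 4} ∪ {z | 3 / 4 ≤ ‖z.2‖ } := fun z _ => le_total ‖z.2‖ (3 / 4)
      rw [← inter_eq_self_of_subset_left e, inter_union_distrib_left]
      have hD : IsClosed (univ ×ˢ Metric.closedBall (0 : V) 1 : Set (I × V)) :=
        isClosed_univ.prod Metric.isClosed_closedBall
      refine ContinuousOn.union_of_isClosed ?_ ?_
        (hD.inter (isClosed_le (by fun_prop) continuous_const))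
        (hD.inter (isClosed_le continuous_const (by fun_prop)))
      -- The radial direction is discontinuous at 0, but for `‖v‖ ≤ 3/4` the truncation is active
      -- and the homotopy is simply `Φ (s • v)`.
      · have : ContinuousOn (fun z : I × V => Φ ((z.1 : ℝ) • z.2))
            (univ ×ˢ Metric.closedBall (0 : V) 1 ∩ {z | ‖z.2‖ ≤ 3 / 4}) := by
          refine h.continuousOn.comp (by fun_prop) fun z hz => ?_
          rw [mem_closedBall_zero_iff, norm_smul, Real.norm_of_nonneg z.1.2.1]
          exact mul_le_one₀ z.1.2.2 (norm_nonneg _) (hnn _ hz.1.2)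
        refine this.congr fun z hz => ?_
        have hz2 : ‖z.2‖ ≤ 3 / 4 := hz.2
        have hm : min (18 - 20 * ‖z.2‖) 2 = 2 := min_eq_right (by linarith)
        have hτ : (1 - (z.1 : ℝ)) * min (18 - 20 * ‖z.2‖) 2 + z.1 * (2 - ‖z.2‖) =
            2 - z.1 * ‖z.2‖ := by rw [hm]; ring
        have hs := mul_le_one₀ z.1.2.2 (norm_nonneg z.2) (hnn _ hz.1.2)
        have hs0 : 0 ≤ (z.1 : ℝ) * ‖z.2‖ := mul_nonneg z.1.2.1 (norm_nonneg _)
        have hlt : (z.1 : ℝ) * ‖z.2‖ < 1 :=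
          (mul_le_of_le_one_left (norm_nonneg z.2) z.1.2.2).trans_lt (by linarith)
        simp only [hτ]
        rw [coneMap, if_neg (by simp only [not_le]; linarith)]
        simp only [sub_sub_cancel, max_eq_left hs0]
        rw [mul_smul, norm_smul_radial]
      · refine hcone.comp (ContinuousOn.prodMk ?_ (by fun_prop)) fun z hz => ⟨?_, trivial⟩
        · refine continuousOn_radial.comp continuousOn_snd fun z hz => ?_
          have hz : 3 / 4 ≤ ‖z.2‖ := hz.2
          exact norm_pos_iff.1 (by linarith)
        · have hz : 3 / 4 ≤ ‖z.2‖ := hz.2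
          exact radial_mem_sphere (norm_pos_iff.1 (by linarith)))
    (by
      intro s v hv
      have hv : ‖v‖ = 1 := by simpa using hv
      have hm : min (18 - 20 * (1 : ℝ)) 2 = -2 := by norm_num
      have hτ : (1 - (s : ℝ)) * min (18 - 20 * 1) 2 + s * (2 - 1) = 3 * s - 2 := by rw [hm]; ring
      simp only [hv, radial_of_norm_eq_one hv, hτ]
      exact coneMap_of_le_one (by linarith [s.2.2]))
  -- the open set and the map from it
  let O₁ : Set (E × V × ℝ) := {z | z.1 ∈ O₀ ∧ z.2.2 < 1}
  let O₂ : Set (E × V × ℝ) := {z | z.2.1 ≠ 0 ∧ dist z.1 (ψ z.2.1) < η}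
  let O₃ : Set (E × V × ℝ) := {z | 4 < z.2.2}
  -- By depth: below 1 apply `r₀`; from 1 to 2 first drag the point of `E` towards `ψ`; from 2 to 3
  -- follow `H₀` from `r₀ ∘ i₀` to the identity on the attaching sphere; from 3 to 4 move inwards
  -- along the radius; beyond 4 stay at `Φ 0`. Direction is therefore needed only on `O₂`.
  let r : E × V × ℝ → Y := fun z =>
    if z.2.2 ≤ 2 then r₀ (z.1 + cl (z.2.2 - 1) • (ψ z.2.1 - z.1))
    else coneMap Φ H₀ (radial z.2.1, z.2.2 - 2)
  have hne : IsOpen {z : E × V × ℝ | z.2.1 ≠ 0} :=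
    isOpen_ne_fun (continuous_fst.comp continuous_snd) continuous_const
  have hψ' : ContinuousOn (fun z : E × V × ℝ => ψ z.2.1) {z | z.2.1 ≠ 0} :=
    hψ.comp (continuous_fst.comp continuous_snd).continuousOn fun z hz => hz
  have hO₁ : IsOpen O₁ := (hO₀.preimage continuous_fst).inter
    (isOpen_lt (continuous_snd.comp continuous_snd) continuous_const)
  have hO₂ : IsOpen O₂ :=
    (continuous_dist.comp_continuousOn (continuousOn_fst.prodMk hψ')).isOpen_inter_preimage
      hne (isOpen_Iio (a := η))
  have hO₃ : IsOpen O₃ := isOpen_lt continuous_const (continuous_snd.comp continuous_snd)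
  have hr₁ : ContinuousOn r O₁ := by
    refine (hr₀.comp continuousOn_fst fun z (hz : z ∈ O₁) => hz.1).congr fun z hz => ?_
    have hz2 : z.2.2 < 1 := hz.2
    have : z.2.2 ≤ 2 := by linarith
    simp only [r, this, if_true, hcl0 (z.2.2 - 1) (by linarith), zero_smul, add_zero,
      Function.comp]
  have hr₂ : ContinuousOn r O₂ := by
    have e : O₂ = O₂ ∩ ({z | z.2.2 ≤ 2} ∪ {z | 2 ≤ z.2.2}) := by
      rw [inter_eq_left.2]
      exact fun z _ => le_total z.2.2 2
    have h1 : ContinuousOn (fun z : E × V × ℝ => r₀ (z.1 + cl (z.2.2 - 1) • (ψ z.2.1 - z.1)))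
        O₂ := by
      refine hr₀.comp (continuousOn_fst.add ((hcl.comp (by fun_prop)).continuousOn.smul
        ((hψ'.mono fun z hz => hz.1).sub continuousOn_fst))) fun z hz => ?_
      refine hball z.2.1 hz.1 ?_
      have hconv := convex_ball (ψ z.2.1) η
      exact hconv.add_smul_sub_mem hz.2 (Metric.mem_ball_self hη) (hclI _)
    have h2 : ContinuousOn (fun z : E × V × ℝ => coneMap Φ H₀ (radial z.2.1, z.2.2 - 2)) O₂ := by
      refine hcone.comp (ContinuousOn.prodMk ?_ (by fun_prop)) fun z hz =>
        ⟨radial_mem_sphere hz.1, trivial⟩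
      exact continuousOn_radial.comp (continuous_fst.comp continuous_snd).continuousOn
        fun z hz => hz.1
    have hsub : EqOn r (fun z => coneMap Φ H₀ (radial z.2.1, z.2.2 - 2))
        (O₂ ∩ {z | 2 ≤ z.2.2}) := by
      rintro z ⟨hz, hz2⟩
      have hz2 : 2 ≤ z.2.2 := hz2
      rcases hz2.eq_or_lt with h' | h'
      · simp only [r, ← h', le_refl, if_true, hcl1 (2 - 1) (by norm_num), one_smul]
        rw [sub_self, coneMap_of_le_zero le_rfl, add_sub_cancel]
        exact (hH0 _ (h.mapsTo_sphere (radial_mem_sphere hz.1))).symm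
      · exact if_neg h'.not_ge
    intro z hz
    refine ContinuousWithinAt.mono (t := O₂ ∩ {z | z.2.2 ≤ 2} ∪ O₂ ∩ {z | 2 ≤ z.2.2}) ?_
      (by rw [← inter_union_distrib_left, ← e])
    have hc1 : ContinuousOn r (O₂ ∩ {z | z.2.2 ≤ 2}) :=
      (h1.mono inter_subset_left).congr fun z hz => if_pos hz.2
    have hc2 : ContinuousOn r (O₂ ∩ {z | 2 ≤ z.2.2}) := (h2.mono inter_subset_left).congr hsub
    -- The two pieces are closed only relative to `O₂`; at a point outside `C`, continuity within
    -- `O₂ ∩ C` is vacuous.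
    have key : ∀ C : Set (E × V × ℝ), IsClosed C → ContinuousOn r (O₂ ∩ C) →
        ContinuousWithinAt r (O₂ ∩ C) z := by
      intro C hC hrC
      by_cases hzC : z ∈ C
      · exact hrC z ⟨hz, hzC⟩
      · refine continuousWithinAt_of_notMem_closure fun hcl => hzC ?_
        exact hC.closure_subset_iff.2 inter_subset_right hcl
    exact (key _ (isClosed_le (by fun_prop) continuous_const) hc1).union
      (key _ (isClosed_le continuous_const (by fun_prop)) hc2)
  have hr₃ : ContinuousOn r O₃ := by
    refine (continuousOn_const (c := Φ 0)).congr fun z hz => ?_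
    have hz : 4 < z.2.2 := hz
    have h1 : ¬ z.2.2 ≤ 2 := by linarith
    have h2 : ¬ z.2.2 - 2 ≤ 1 := by linarith
    simp only [r, h1, if_false, coneMap, h2]
    rw [max_eq_right (by linarith), zero_smul]
  have hs : ∀ v : V, v ∈ Metric.closedBall (0 : V) 1 → v ∈ Metric.sphere (0 : V) 1 ∨
      (0 < 1 - ‖v‖) := by
    intro v hv
    rcases (hnn v hv).eq_or_lt with h' | h'
    · exact Or.inl (by simpa using h')
    · exact Or.inr (by linarith)
  have hi0 : ∀ y ∈ L₀, bi ((), y) ∈ O₁ ∧ r (bi ((), y)) = H₀ (0, y) := by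
    intro y hy
    rw [hbi1 _ _ hy]
    refine ⟨⟨hiO₀ hy, zero_lt_one⟩, ?_⟩
    have : (0 : ℝ) ≤ 2 := zero_le_two
    simp only [r, this, if_true, hcl0 (0 - 1) (by norm_num), zero_smul, add_zero]
    exact (hH0 y hy).symm
  refine ⟨E × V × ℝ, inferInstance, inferInstance, inferInstance, O₁ ∪ O₂ ∪ O₃,
    fun y => bi ((), y), r, bH, (hO₁.union hO₂).union hO₃, ?_, ?_, ?_, hbH, ?_, ?_⟩
  · exact hbi.comp (continuous_const.prodMk continuous_id).continuousOn
      fun y hy => ⟨trivial, hy⟩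
  · rintro y (hy | ⟨v, hv, rfl⟩)
    · exact Or.inl (Or.inl (hi0 y hy).1)
    · rcases hs v hv with hv' | hv'
      · exact Or.inl (Or.inl (hi0 _ (h.mapsTo_sphere hv')).1)
      · change bi ((), Φ v) ∈ _
        rw [hbi2 _ _ hv]
        rcases le_or_gt (20 * (1 - ‖v‖)) 4 with h4 | h4
        · refine Or.inl (Or.inr ?_)
          have hv0 : v ≠ 0 := norm_pos_iff.1 (by linarith)
          refine ⟨smul_ne_zero hv'.ne' hv0, ?_⟩
          simp only [B, hcl1 (4 * ‖v‖ - 2) (by linarith), one_smul, ψ, radial_smul hv', dist_self]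
          exact hη
        · exact Or.inr h4
  · exact (hr₁.union_of_isOpen hr₂ hO₁ hO₂).union_of_isOpen hr₃ (hO₁.union hO₂) hO₃
  · rintro y (hy | ⟨v, hv, rfl⟩)
    · rw [hbH1 _ _ hy, (hi0 y hy).2]
      congr 2
      exact projIcc_of_le_left _ (by norm_num)
    · rcases hs v hv with hv' | hv'
      · have hy := h.mapsTo_sphere hv'
        rw [hbH1 _ _ hy, (hi0 _ hy).2]
        congr 2
        exact projIcc_of_le_left _ (by norm_num)
      · change bH (0, Φ v) = r (bi ((), Φ v))
        rw [hbH2 _ _ hv, hbi2 _ _ hv]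
        have e0 : (1 - ((0 : I) : ℝ)) * min (18 - 20 * ‖v‖) 2 + ((0 : I) : ℝ) * (2 - ‖v‖) =
            min (18 - 20 * ‖v‖) 2 := by simp
        simp only [e0, r, B, radial_smul hv']
        split_ifs with h2
        · have hv0 : v ≠ 0 := norm_pos_iff.1 (by linarith)
          rw [hcl1 (4 * ‖v‖ - 2) (by linarith), one_smul]
          change _ = r₀ (ψ v + _ • (ψ ((1 - ‖v‖) • v) - ψ v))
          have : ψ ((1 - ‖v‖) • v) = ψ v := by simp only [ψ, radial_smul hv']
          rw [this, sub_self, smul_zero, add_zero, coneMap_of_le_zero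
            ((min_le_left _ _).trans (by linarith))]
          exact hH0 _ (h.mapsTo_sphere (radial_mem_sphere hv0))
        · have e1 : 20 * (1 - ‖v‖) - 2 = 18 - 20 * ‖v‖ := by ring
          rw [e1]
          rcases le_total (18 - 20 * ‖v‖) 2 with h3 | h3
          · rw [min_eq_left h3]
          · rw [min_eq_right h3, coneMap, coneMap, if_neg (by norm_num), if_neg (by linarith)]
            simp only [sub_self, max_self, zero_smul]
            rw [max_eq_right (by linarith), zero_smul]
  · rintro y (hy | ⟨v, hv, rfl⟩)
    · rw [hbH1 _ _ hy]
      have : projIcc (0 : ℝ) 1 zero_le_one (3 * ((1 : I) : ℝ) - 2) = 1 :=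
        projIcc_of_right_le _ (by norm_num)
      rw [this, hH1 y hy]
    · rw [hbH2 _ _ hv]
      have e1 : (1 - ((1 : I) : ℝ)) * min (18 - 20 * ‖v‖) 2 + ((1 : I) : ℝ) * (2 - ‖v‖) =
          2 - ‖v‖ := by simp
      simp only [e1]
      have hv1 := hnn v hv
      rcases eq_or_ne v 0 with rfl | hv0
      · rw [coneMap, if_neg (by simp)]
        simp [radial]
      · rw [coneMap_of_one_le (by linarith)
          (hH1 _ (h.mapsTo_sphere (radial_mem_sphere hv0))), sub_sub_cancel,
          max_eq_left (norm_nonneg v), norm_smul_radial]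

end Attach

/-! ### Compact subsets of CW complexes -/

namespace Topology.CWComplex

variable {Y : Type*} [TopologicalSpace Y] [CWComplex (univ : Set Y)]

/-- The union of the open cells in a finite set of cells. -/
def cellUnion (S : Finset (Σ n, cell (univ : Set Y) n)) : Set Y :=
  ⋃ e ∈ S, openCell e.1 e.2

/-- Finite sets of cells which are obtained by successively adding cells whose frontier lies in the
union of the cells which are already present. -/
inductive IsAttachable : Finset (Σ n, cell (univ : Set Y) n) → Prop
  | empty : IsAttachable ∅
  | insert (S : Finset (Σ n, cell (univ : Set Y) n)) (e : Σ n, cell (univ : Set Y) n)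
      (hS : IsAttachable S) (he : e ∉ S) (hfr : cellFrontier e.1 e.2 ⊆ cellUnion S) :
      IsAttachable (S.cons e he)

theorem cellUnion_mono {S S' : Finset (Σ n, cell (univ : Set Y) n)} (h : S ⊆ S') :
    cellUnion S ⊆ cellUnion S' :=
  biUnion_subset_biUnion_left h

theorem cellUnion_cons (S : Finset (Σ n, cell (univ : Set Y) n)) (e) (he : e ∉ S) :
    cellUnion (S.cons e he) = openCell e.1 e.2 ∪ cellUnion S := by
  simp [cellUnion]

theorem IsAttachable.closedCell_subset {S : Finset (Σ n, cell (univ : Set Y) n)}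
    (hS : IsAttachable S) : ∀ e ∈ S, closedCell e.1 e.2 ⊆ cellUnion S := by
  induction hS with
  | empty => simp
  | insert S e hS he hfr ih =>
    intro e' he'
    have hsub : cellUnion S ⊆ cellUnion (S.cons e he) := cellUnion_mono (Finset.subset_cons he)
    rcases Finset.mem_cons.1 he' with rfl | he'
    · rw [← cellFrontier_union_openCell_eq_closedCell]
      refine union_subset (hfr.trans hsub) ?_
      rw [cellUnion_cons]
      exact subset_union_left
    · exact (ih e' he').trans hsub

theorem IsAttachable.cellUnion_cons_eq {S : Finset (Σ n, cell (univ : Set Y) n)}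
    {e} {he : e ∉ S} (hfr : cellFrontier e.1 e.2 ⊆ cellUnion S) :
    cellUnion (S.cons e he) = cellUnion S ∪ closedCell e.1 e.2 := by
  rw [cellUnion_cons, ← cellFrontier_union_openCell_eq_closedCell, ← union_assoc,
    union_eq_self_of_subset_right hfr, union_comm]

theorem IsAttachable.isCompact_cellUnion {S : Finset (Σ n, cell (univ : Set Y) n)}
    (hS : IsAttachable S) : IsCompact (cellUnion S) := by
  induction hS with
  | empty => simp [cellUnion]
  | insert S e hS he hfr ih =>
    rw [IsAttachable.cellUnion_cons_eq hfr]
    exact ih.union isCompact_closedCell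

theorem IsAttachable.isOpenDominated [T2Space Y] [Nonempty Y]
    {S : Finset (Σ n, cell (univ : Set Y) n)} (hS : IsAttachable S) :
    IsOpenDominated (cellUnion S) := by
  induction hS with
  | empty => simpa [cellUnion] using IsOpenDominated.empty
  | insert S e hS he hfr ih =>
    rw [IsAttachable.cellUnion_cons_eq hfr]
    refine IsOpenDominated.attach ⟨hS.isCompact_cellUnion.isClosed, continuousOn e.1 e.2,
      mapsTo_iff_image_subset.2 hfr, ?_, ?_⟩ ih
    · rw [← source_eq e.1 e.2]
      exact (map e.1 e.2).injOn
    · intro v hv hmem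
      obtain ⟨e', he', h'⟩ := mem_iUnion₂.1 hmem
      have hne : e ≠ e' := fun h => he (h ▸ he')
      exact disjoint_left.1 (disjoint_openCell_of_ne (i := e.2) (j := e'.2) hne)
        (mem_image_of_mem _ hv) h'

/-- Induction on dimension: the frontier of a cell lies in finitely many closed cells of lower
dimension, which can be added first. -/
theorem exists_isAttachable_mem (n : ℕ) : ∀ (S : Finset (Σ n, cell (univ : Set Y) n)),
    IsAttachable S → ∀ e : cell (univ : Set Y) n, ∃ S', IsAttachable S' ∧ S ⊆ S' ∧ ⟨n, e⟩ ∈ S' := by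
  classical
  induction n using Nat.strong_induction_on with
  | _ n ih =>
    intro S hS e
    by_cases he : (⟨n, e⟩ : Σ n, cell (univ : Set Y) n) ∈ S
    · exact ⟨S, hS, subset_rfl, he⟩
    obtain ⟨J, hJ⟩ := cellFrontier_subset_finite_closedCell n e
    have key : ∀ R : Finset (Σ n, cell (univ : Set Y) n), (∀ e ∈ R, e.1 < n) →
        ∃ S', IsAttachable S' ∧ S ⊆ S' ∧ R ⊆ S' := by
      intro R
      induction R using Finset.induction_on with
      | empty => exact fun _ => ⟨S, hS, subset_rfl, by simp⟩
      | insert e' R _ ihR =>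
        intro hR
        obtain ⟨S₁, h1, h2, h3⟩ := ihR fun e he => hR e (Finset.mem_insert_of_mem he)
        obtain ⟨S₂, h4, h5, h6⟩ := ih e'.1 (hR e' (Finset.mem_insert_self _ _)) S₁ h1 e'.2
        exact ⟨S₂, h4, h2.trans h5, Finset.insert_subset h6 (h3.trans h5)⟩
    obtain ⟨S₁, h1, h2, h3⟩ := key ((Finset.range n).sigma J) fun e he =>
      Finset.mem_range.1 (Finset.mem_sigma.1 he).1
    by_cases he1 : (⟨n, e⟩ : Σ n, cell (univ : Set Y) n) ∈ S₁
    · exact ⟨S₁, h1, h2, he1⟩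
    refine ⟨S₁.cons ⟨n, e⟩ he1, .insert _ _ h1 he1 (hJ.trans ?_),
      h2.trans (Finset.subset_cons he1), by simp⟩
    refine iUnion₂_subset fun k hk => iUnion₂_subset fun e' he' => ?_
    exact h1.closedCell_subset ⟨k, e'⟩
      (h3 (Finset.mem_sigma.2 ⟨Finset.mem_range.2 hk, he'⟩))

theorem exists_isAttachable_superset (R : Finset (Σ n, cell (univ : Set Y) n)) :
    ∃ S, IsAttachable S ∧ R ⊆ S := by
  classical
  induction R using Finset.induction_on with
  | empty => exact ⟨∅, .empty, subset_rfl⟩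
  | insert e R _ ih =>
    obtain ⟨S, h1, h2⟩ := ih
    obtain ⟨S', h3, h4, h5⟩ := exists_isAttachable_mem e.1 S h1 e.2
    exact ⟨S', h3, Finset.insert_subset h5 (h2.trans h4)⟩

/-- A set which meets every open cell in at most one point is closed. -/
theorem isClosed_of_subsingleton_inter [T2Space Y] (Q : Set Y)
    (hQ : ∀ e : Σ n, cell (univ : Set Y) n, (Q ∩ openCell e.1 e.2).Subsingleton) : IsClosed Q := by
  rw [closed (univ : Set Y) Q (subset_univ _)]
  intro n e
  obtain ⟨S, hS, he⟩ := exists_isAttachable_superset {(⟨n, e⟩ : Σ n, cell (univ : Set Y) n)}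
  -- A closed cell is covered by finitely many open cells, so it meets `Q` in a finite set.
  refine Set.Finite.isClosed (Set.Finite.subset (s := ⋃ e ∈ S, Q ∩ openCell e.1 e.2) ?_ ?_)
  · exact S.finite_toSet.biUnion fun e _ => (hQ e).finite
  · rw [← inter_iUnion₂]
    exact inter_subset_inter_right _ (hS.closedCell_subset ⟨n, e⟩ (he (by simp)))

/-- A compact subset of a CW complex meets only finitely many open cells. -/
theorem finite_meets_of_isCompact [T2Space Y] [Nonempty Y] {C : Set Y} (hC : IsCompact C) :
    {e : Σ n, cell (univ : Set Y) n | (C ∩ openCell e.1 e.2).Nonempty}.Finite := by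
  set M := {e : Σ n, cell (univ : Set Y) n | (C ∩ openCell e.1 e.2).Nonempty}
  choose! g hg using fun (e : Σ n, cell (univ : Set Y) n) (he : e ∈ M) => he
  have hinj : InjOn g M := by
    intro e he e' he' h
    by_contra hne
    exact disjoint_left.1 (disjoint_openCell_of_ne (i := e.2) (j := e'.2) hne)
      (hg e he).2 (h ▸ (hg e' he').2)
  -- One point is chosen in each open cell that is met. All sets of chosen points are closed, so the
  -- chosen points form a compact discrete set, which is finite.
  have hclosed : ∀ Q ⊆ g '' M, IsClosed Q := by
    intro Q hQ
    refine isClosed_of_subsingleton_inter Q fun e => ?_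
    rintro _ ⟨hx, hxe⟩ _ ⟨hy, hye⟩
    obtain ⟨a, ha, rfl⟩ := hQ hx
    obtain ⟨b, hb, rfl⟩ := hQ hy
    have h1 : a = e := by
      by_contra hne
      exact disjoint_left.1 (disjoint_openCell_of_ne (i := a.2) (j := e.2) hne) (hg a ha).2 hxe
    have h2 : b = e := by
      by_contra hne
      exact disjoint_left.1 (disjoint_openCell_of_ne (i := b.2) (j := e.2) hne) (hg b hb).2 hye
    rw [h1, h2]
  have hcpt : IsCompact (g '' M) := hC.of_isClosed_subset (hclosed _ subset_rfl) (by
    rintro _ ⟨e, he, rfl⟩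
    exact (hg e he).1)
  have hdisc : IsDiscrete (g '' M) := by
    refine ⟨discreteTopology_iff_forall_isClosed.2 fun Q => ?_⟩
    have := (hclosed (Subtype.val '' Q) (by simp)).preimage
      (continuous_subtype_val (p := (· ∈ g '' M)))
    rwa [preimage_image_eq _ Subtype.val_injective] at this
  exact (hcpt.finite hdisc).of_finite_image hinj

theorem isOpenDominated_of_isCompact [T2Space Y] [Nonempty Y] {C : Set Y} (hC : IsCompact C) :
    IsOpenDominated C := by
  obtain ⟨S, hS, hR⟩ := exists_isAttachable_superset (finite_meets_of_isCompact hC).toFinset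
  refine hS.isOpenDominated.mono fun y hy => ?_
  have : y ∈ (⋃ (n : ℕ) (j : cell (univ : Set Y) n), openCell n j) := by
    rw [iUnion_openCell_eq_complex]; trivial
  obtain ⟨n, e, he⟩ := mem_iUnion₂.1 this
  have hmem : (⟨n, e⟩ : Σ n, cell (univ : Set Y) n) ∈ S :=
    hR ((Set.Finite.mem_toFinset _).2 ⟨y, hy, he⟩)
  exact mem_biUnion hmem he

/-- A finite CW complex is compact. -/
theorem compactSpace_of_finite [CWComplex.Finite (univ : Set Y)] : CompactSpace Y := by
  have := RelCWComplex.finite_cells_of_finite (C := (univ : Set Y))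
  refine ⟨?_⟩
  have e : (univ : Set Y) = ⋃ e : Σ n, cell (univ : Set Y) n, closedCell e.1 e.2 := by
    rw [iUnion_sigma]
    exact union.symm
  rw [e]
  exact isCompact_iUnion fun e => isCompact_closedCell

end Topology.CWComplex

/-! ### Maps out of an inverse limit of compact spaces -/

namespace InvLimit

variable {ι : Type*} [Preorder ι] [IsDirectedOrder ι] {K : ι → Type*} [∀ j, TopologicalSpace (K j)]
  [∀ j, CompactSpace (K j)] [∀ j, T2Space (K j)] {X : Type*} [TopologicalSpace X]
  {p : ∀ ⦃i j : ι⦄, i ≤ j → C(K j, K i)}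
  {h : ∀ j, C(X, K j)} {hh : ∀ i j (hij : i ≤ j) (x : X), p hij (h j x) = h i x}

/-- A neighbourhood of the image of the limit contains the image of some later stage. -/
theorem exists_forall_mem
    [hp : InverseSystem fun (i j : ι) (hij : i ≤ j) => (p hij : K j → K i)]
    (hsurj : Function.Surjective (toInvLimit p h hh)) (j : ι)
    {W : Set (K j)} (hW : IsOpen W) (hWX : ∀ x, h j x ∈ W) : ∃ k, ∃ hjk : j ≤ k, ∀ y, p hjk y ∈ W := by
  classical
  by_contra! hcon
  have hne : ∀ i, Nonempty (K i) := fun i => by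
    obtain ⟨k, hik, hjk⟩ := exists_ge_ge i j
    obtain ⟨y, -⟩ := hcon k hjk
    exact ⟨p hik y⟩
  -- `S k` consists of the families that are threads below `k` and avoid `W` at `j`, with no
  -- condition on the other coordinates. These sets are closed, decreasing and nonempty in a compact
  -- product; a common point is a thread avoiding `W`.
  let S : Set.Ici j → Set (∀ i, K i) := fun k =>
    {x | (∀ i (hik : i ≤ k.1), p hik (x k) = x i) ∧ x j ∉ W}
  have hS : ∀ k, IsClosed (S k) := fun k => by
    have e : S k = (⋂ (i) (hik : i ≤ k.1), {x | p hik (x k) = x i}) ∩ {x | x j ∉ W} := by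
      ext x; simp [S]
    rw [e]
    refine (isClosed_iInter fun i => isClosed_iInter fun hik => ?_).inter ?_
    · exact isClosed_eq ((p hik).continuous.comp (continuous_apply _)) (continuous_apply _)
    · exact hW.isClosed_compl.preimage (continuous_apply j)
  have hanti : ∀ k l : Set.Ici j, k ≤ l → S l ⊆ S k := by
    rintro k l hkl x ⟨hx, hxW⟩
    refine ⟨fun i hik => ?_, hxW⟩
    rw [← hx k hkl, ← hx i (hik.trans hkl)]
    exact hp.map_map hik hkl _
  have : Nonempty (Set.Ici j) := ⟨⟨j, le_rfl⟩⟩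
  obtain ⟨x, hx⟩ := IsCompact.nonempty_iInter_of_directed_nonempty_isCompact_isClosed S
    (fun k l => by
      obtain ⟨m, hkm, hlm⟩ := exists_ge_ge k l
      exact ⟨m, hanti _ _ hkm, hanti _ _ hlm⟩)
    (fun k => by
      obtain ⟨y, hy⟩ := hcon k.1 k.2
      let x : ∀ i, K i := fun i => if hik : i ≤ k.1 then p hik y else (hne i).some
      have hxi : ∀ i (hik : i ≤ k.1), x i = p hik y := fun i hik => dif_pos hik
      refine ⟨x, fun i hik => ?_, ?_⟩
      · rw [hxi i hik, hxi k.1 le_rfl]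
        exact hp.map_map hik le_rfl y
      · rw [hxi j k.2]
        exact hy)
    (fun k => (hS k).isCompact) hS
  rw [mem_iInter] at hx
  obtain ⟨z, hz⟩ := hsurj ⟨x, fun i k hik => by
    obtain ⟨l, hkl, hjl⟩ := exists_ge_ge k j
    have := (hx ⟨l, hjl⟩).1
    rw [← this k hkl, ← this i (hik.trans hkl)]
    exact hp.map_map hik hkl _⟩
  have hzj : h j z = x j := congrFun (congrArg Subtype.val hz) j
  exact (hx ⟨j, le_rfl⟩).2 (hzj ▸ hWX z)

/-! ### Approximation of maps on `T × X` by maps from a stage. -/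

variable {T : Type*} [TopologicalSpace T]

theorem exists_forall_prod_mem [CompactSpace T]
    [hp : InverseSystem fun (i j : ι) (hij : i ≤ j) => (p hij : K j → K i)]
    (hsurj : Function.Surjective (toInvLimit p h hh))
    (j : ι) {W : Set (T × K j)} (hW : IsOpen W) (hWX : ∀ t x, (t, h j x) ∈ W) :
    ∃ k, ∃ hjk : j ≤ k, ∀ t y, (t, p hjk y) ∈ W := by
  have hW' : IsOpen {y : K j | ∀ t : T, (t, y) ∈ W} := by
    have e : {y : K j | ∀ t : T, (t, y) ∈ W} = (Prod.snd '' Wᶜ)ᶜ := by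
      ext y; simp
    rw [e]
    exact (isClosedMap_snd_of_compactSpace _ hW.isClosed_compl).isOpen_compl
  obtain ⟨k, hjk, hk⟩ := exists_forall_mem hsurj j hW' fun x t => hWX t x
  exact ⟨k, hjk, fun t y => hk y t⟩

/-- The functions on `T × X` which come from some stage. -/
def stageFunctions (p : ∀ ⦃i j : ι⦄, i ≤ j → C(K j, K i)) (h : ∀ j, C(X, K j))
    (hh : ∀ i j (hij : i ≤ j) (x : X), p hij (h j x) = h i x) (T : Type*) [TopologicalSpace T]
    (j : ι) : Subalgebra ℝ C(T × X, ℝ) where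
  carrier := {u | ∃ k, ∃ _ : j ≤ k, ∃ w : C(T × K k, ℝ), ∀ t x, u (t, x) = w (t, h k x)}
  mul_mem' := by
    rintro u u' ⟨k, hk, w, hw⟩ ⟨k', hk', w', hw'⟩
    obtain ⟨l, hl, hl'⟩ := exists_ge_ge k k'
    refine ⟨l, hk.trans hl, w.comp ((ContinuousMap.id T).prodMap (p hl)) *
      w'.comp ((ContinuousMap.id T).prodMap (p hl')), fun t x => ?_⟩
    simp [hw, hw', hh]
  add_mem' := by
    rintro u u' ⟨k, hk, w, hw⟩ ⟨k', hk', w', hw'⟩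
    obtain ⟨l, hl, hl'⟩ := exists_ge_ge k k'
    refine ⟨l, hk.trans hl, w.comp ((ContinuousMap.id T).prodMap (p hl)) +
      w'.comp ((ContinuousMap.id T).prodMap (p hl')), fun t x => ?_⟩
    simp [hw, hw', hh]
  algebraMap_mem' r := ⟨j, le_rfl, ContinuousMap.const _ r, fun t x => rfl⟩

/-- Stone–Weierstrass for `stageFunctions`. Points are separated by Urysohn functions on `T × K k`,
since distinct points of `X` already differ at some stage. -/
theorem exists_near_real [CompactSpace T] [T2Space T] [CompactSpace X]
    (hinj : Function.Injective (toInvLimit p h hh)) (j : ι) (D : C(T × X, ℝ)) {ε : ℝ}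
    (hε : 0 < ε) :
    ∃ k, ∃ _ : j ≤ k, ∃ w : C(T × K k, ℝ), ∀ t x, |w (t, h k x) - D (t, x)| < ε := by
  have hsep : (stageFunctions p h hh T j).SeparatesPoints := by
    have key : ∀ k, j ≤ k → ∀ t x t' x', (t, h k x) ≠ (t', h k x') →
        ∃ f ∈ (fun f : C(T × X, ℝ) => (f : T × X → ℝ)) '' (stageFunctions p h hh T j),
          f (t, x) ≠ f (t', x') := by
      intro k hk t x t' x' hne
      obtain ⟨w, hw0, hw1, -⟩ := exists_continuous_zero_one_of_isClosed
        (isClosed_singleton (x := (t, h k x))) (isClosed_singleton (x := (t', h k x')))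
        (by simpa using hne)
      refine ⟨_, ⟨w.comp ((ContinuousMap.id T).prodMap (h k)), ⟨k, hk, w, fun t x => rfl⟩, rfl⟩, ?_⟩
      have e0 : w (t, h k x) = 0 := hw0 rfl
      have e1 : w (t', h k x') = 1 := hw1 rfl
      change w (t, h k x) ≠ w (t', h k x')
      rw [e0, e1]
      exact zero_ne_one
    rintro ⟨t, x⟩ ⟨t', x'⟩ hne
    by_cases ht : t = t'
    · have hx : x ≠ x' := fun hx => hne (by rw [ht, hx])
      have : ∃ i, h i x ≠ h i x' := by
        by_contra! hcon
        exact hx (hinj (Subtype.ext (funext hcon)))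
      obtain ⟨i, hi⟩ := this
      obtain ⟨k, hik, hjk⟩ := exists_ge_ge i j
      refine key k hjk t x t' x' fun heq => hi ?_
      have := congrArg (fun z => p hik z.2) heq
      simpa [hh] using this
    · exact key j le_rfl t x t' x' fun heq => ht (congrArg Prod.fst heq)
  obtain ⟨⟨u, k, hk, w, hw⟩, hu⟩ :=
    ContinuousMap.exists_mem_subalgebra_near_continuousMap_of_separatesPoints
      (stageFunctions p h hh T j) hsep D ε hε
  refine ⟨k, hk, w, fun t x => ?_⟩
  have := (ContinuousMap.norm_lt_iff _ hε).1 hu (t, x)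
  rw [← hw]
  simpa using this

variable {E : Type*} [NormedAddCommGroup E] [NormedSpace ℝ E]

theorem exists_near [FiniteDimensional ℝ E] [CompactSpace T] [T2Space T] [CompactSpace X]
    (hinj : Function.Injective (toInvLimit p h hh)) (j : ι) (D : C(T × X, E)) {ε : ℝ}
    (hε : 0 < ε) :
    ∃ k, ∃ _ : j ≤ k, ∃ w : C(T × K k, E), ∀ t x, ‖w (t, h k x) - D (t, x)‖ < ε := by
  let b := Module.finBasis ℝ E
  have hcoord : ∀ i, Continuous (b.coord i) := fun i => LinearMap.continuous_of_finiteDimensional _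
  have hM : 0 < ∑ i, ‖b i‖ + 1 := by positivity
  -- Tolerance for each coordinate in the basis `b`; the `+ 1` avoids division by 0 and makes the
  -- final bound strict.
  have hδ : 0 < ε / (∑ i, ‖b i‖ + 1) := div_pos hε hM
  choose k hk w hw using fun i => exists_near_real hinj j
    ((⟨_, hcoord i⟩ : C(E, ℝ)).comp D) hδ
  have : Nonempty ι := ⟨j⟩
  obtain ⟨l, hl⟩ : ∃ l, ∀ i, k i ≤ l := Finite.exists_le k
  obtain ⟨l', hjl, hll⟩ := exists_ge_ge j l
  refine ⟨l', hjl, ⟨fun z => ∑ i, w i (z.1, p ((hl i).trans hll) z.2) • b i, by fun_prop⟩,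
    fun t x => ?_⟩
  have e : D (t, x) = ∑ i, b.coord i (D (t, x)) • b i := (b.sum_repr _).symm
  rw [e]
  simp only [ContinuousMap.coe_mk, hh, ← Finset.sum_sub_distrib, ← sub_smul]
  calc ‖∑ i, (w i (t, h (k i) x) - b.coord i (D (t, x))) • b i‖
      ≤ ∑ i, ε / (∑ i, ‖b i‖ + 1) * ‖b i‖ := by
        refine norm_sum_le_of_le _ fun i _ => ?_
        rw [norm_smul]
        exact mul_le_mul_of_nonneg_right (hw i t x).le (norm_nonneg _)
    _ = ε * ((∑ i, ‖b i‖) / (∑ i, ‖b i‖ + 1)) := by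
        rw [← Finset.mul_sum]; ring
    _ < ε * 1 := by
        refine mul_lt_mul_of_pos_left ?_ hε
        rw [div_lt_one hM]; linarith
    _ = ε := mul_one ε

/-- A map from `T × X` to an open subset `O` of a normed space which on `A × X` comes from stage
`j` can be approximated by a map from a later stage which on `A` is the given one. -/
theorem exists_stage_map
    [hp : InverseSystem fun (i j : ι) (hij : i ≤ j) => (p hij : K j → K i)]
    [FiniteDimensional ℝ E] [CompactSpace T] [T2Space T] [CompactSpace X]
    (hinj : Function.Injective (toInvLimit p h hh))
    (hsurj : Function.Surjective (toInvLimit p h hh)) (j : ι) {O : Set E} (hO : IsOpen O)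
    {A : Set T} (hA : IsClosed A) (F : C(T × X, E)) (hF : ∀ z, F z ∈ O) (g : C(T × K j, E))
    (hg : ∀ t ∈ A, ∀ x, F (t, x) = g (t, h j x)) :
    ∃ k, ∃ hjk : j ≤ k, ∃ G : C(T × K k, E), (∀ z, G z ∈ O) ∧
      (∀ t ∈ A, ∀ y, G (t, y) = g (t, p hjk y)) ∧
      ∀ t x, ∀ s : I, F (t, x) + (s : ℝ) • (G (t, h k x) - F (t, x)) ∈ O := by
  obtain ⟨η, hη, hηO⟩ := (isCompact_range F.continuous).exists_thickening_subset_open hO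
    (range_subset_iff.2 hF)
  have hball : ∀ z, Metric.ball (F z) η ⊆ O := fun z e he =>
    hηO (Metric.mem_thickening_iff.2 ⟨F z, mem_range_self z, he⟩)
  let D : C(T × X, E) := F - g.comp ((ContinuousMap.id T).prodMap (h j))
  have hDA : ∀ t ∈ A, ∀ x, D (t, x) = 0 := fun t ht x => sub_eq_zero.2 (hg t ht x)
  let N : Set T := {t | ∀ x, ‖D (t, x)‖ < η / 2}
  have hN : IsOpen N := by
    have e : N = (Prod.fst '' {z | η / 2 ≤ ‖D z‖})ᶜ := by
      ext t; simp [N]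
    rw [e]
    exact (isClosedMap_fst_of_compactSpace _
      (isClosed_le continuous_const D.continuous.norm)).isOpen_compl
  obtain ⟨χ, hχ0, hχ1, hχI⟩ := exists_continuous_zero_one_of_isClosed hA hN.isClosed_compl
    (disjoint_compl_right_iff_subset.2 fun t ht x => by
      rw [hDA t ht x, norm_zero]; exact half_pos hη)
  obtain ⟨k, hjk, w, hw⟩ := exists_near hinj j D (half_pos hη)
  -- Correct `g` by the approximation `w` of the error `D`, cut off by `χ`, which is 0 on `A` and 1
  -- wherever `D` may be large. The remaining error is a convex combination of `w - D` and `-D`,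
  -- each below `η / 2` where its weight is nonzero.
  let G : C(T × K k, E) := ⟨fun z => g (z.1, p hjk z.2) + χ z.1 • w z, by fun_prop⟩
  have hG : ∀ t x, G (t, h k x) ∈ Metric.ball (F (t, x)) η := by
    intro t x
    rw [mem_ball_iff_norm]
    have e : G (t, h k x) - F (t, x) =
        χ t • (w (t, h k x) - D (t, x)) + (1 - χ t) • -D (t, x) := by
      have : F (t, x) = g (t, h j x) + D (t, x) := by simp [D]
      rw [this]
      simp only [G, ContinuousMap.coe_mk, hh]
      module
    rw [e]
    have h1 : ‖(1 - χ t) • -D (t, x)‖ ≤ (1 - χ t) * (η / 2) := by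
      rw [norm_smul, norm_neg, Real.norm_of_nonneg (by linarith [(hχI t).2])]
      by_cases ht : t ∈ N
      · exact mul_le_mul_of_nonneg_left (ht x).le (by linarith [(hχI t).2])
      · have : χ t = 1 := hχ1 ht
        simp [this]
    have h2 : ‖χ t • (w (t, h k x) - D (t, x))‖ ≤ χ t * (η / 2) := by
      rw [norm_smul, Real.norm_of_nonneg (hχI t).1]
      exact mul_le_mul_of_nonneg_left (hw t x).le (hχI t).1
    calc _ ≤ χ t * (η / 2) + (1 - χ t) * (η / 2) := (norm_add_le _ _).trans (add_le_add h2 h1)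
      _ = η / 2 := by ring
      _ < η := half_lt_self hη
  -- So far `G` is known to lie in `O` only over the image of `X`; a later stage maps entirely into
  -- the good set.
  obtain ⟨l, hkl, hl⟩ := exists_forall_prod_mem hsurj k (hO.preimage G.continuous)
    fun t x => hball _ (hG t x)
  refine ⟨l, hjk.trans hkl, G.comp ((ContinuousMap.id T).prodMap (p hkl)), fun z => hl z.1 z.2,
    fun t ht y => ?_, fun t x s => ?_⟩
  · have : χ t = 0 := hχ0 ht
    have e : p hjk (p hkl y) = p (hjk.trans hkl) y := hp.map_map hjk hkl y
    simp [G, this, e]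
  · have e : (G.comp ((ContinuousMap.id T).prodMap (p hkl))) (t, h l x) = G (t, h k x) := by
      simp [hh]
    rw [e]
    exact hball _ ((convex_ball (F (t, x)) η).add_smul_sub_mem (Metric.mem_ball_self hη)
      (hG t x) s.2)

end InvLimit

/-! ### Generalized loops in function spaces -/

namespace FunSpace

theorem precomp_precomp {X Y Z W : Type*} [TopologicalSpace X] [TopologicalSpace Y]
    [TopologicalSpace Z] [TopologicalSpace W] (g : C(X, Z)) (k : C(Z, W)) (l : C(X, W))
    (hl : ∀ x, k (g x) = l x) (u : FunSpace W Y) : precomp g (precomp k u) = precomp l u :=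
  ContinuousMap.ext fun x => congrArg ((CompactCoherentification.mk C(W, Y)).symm u) (hl x)

variable {X Y : Type*} [TopologicalSpace X] [TopologicalSpace Y] [LocallyCompactSpace X] {n : ℕ}

/-- The map on `I^n × X` which corresponds to a map from the cube `I^n` to the function space. -/
noncomputable def uncurryLoop {f : C(X, Y)} (q : Ω^ (Fin n) (FunSpace X Y) (of f)) :
    C((Fin n → I) × X, Y) where
  toFun z := (CompactCoherentification.mk C(X, Y)).symm (q z.1) z.2
  continuous_toFun := by
    have : Continuous fun z : (Fin n → I) × X =>
        (CompactCoherentification.mk C(X, Y)).symm (q z.1) :=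
      CompactCoherentification.continuous_mk_symm.comp (q.1.continuous.comp continuous_fst)
    fun_prop

theorem uncurryLoop_boundary {f : C(X, Y)} (q : Ω^ (Fin n) (FunSpace X Y) (of f)) :
    ∀ t ∈ Cube.boundary (Fin n), ∀ x, uncurryLoop q (t, x) = f x := fun t ht x =>
  congrArg (fun u => (CompactCoherentification.mk C(X, Y)).symm u x) (q.2 t ht)

theorem exists_uncurryLoop_eq {f : C(X, Y)} (G : C((Fin n → I) × X, Y))
    (hG : ∀ t ∈ Cube.boundary (Fin n), ∀ x, G (t, x) = f x) :
    ∃ q : Ω^ (Fin n) (FunSpace X Y) (of f), uncurryLoop q = G :=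
  ⟨⟨⟨fun t => of (G.curry t),
    CompactCoherentification.continuous_rng_of_compactSpace.2 G.curry.continuous⟩,
    fun t ht => congrArg of (ContinuousMap.ext fun x => hG t ht x)⟩, rfl⟩

/-- Currying: passing to the compactly generated topology does not change continuity of maps from
the compact space `I × I^n`, and evaluation is continuous because `X` is locally compact. -/
theorem homotopic_iff {f : C(X, Y)} (q q' : Ω^ (Fin n) (FunSpace X Y) (of f)) :
    GenLoop.Homotopic q q' ↔
      Cube.HomotopicAlong (Cube.constPath f) (uncurryLoop q) (uncurryLoop q') := by
  constructor
  · rintro ⟨H⟩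
    have hc : Continuous fun z : I × (Fin n → I) × X =>
        (CompactCoherentification.mk C(X, Y)).symm (H (z.1, z.2.1)) :=
      CompactCoherentification.continuous_mk_symm.comp (by fun_prop)
    have hev : ∀ {u v : FunSpace X Y}, u = v → ∀ x,
        (CompactCoherentification.mk C(X, Y)).symm u x =
          (CompactCoherentification.mk C(X, Y)).symm v x := by
      rintro u _ rfl x; rfl
    refine ⟨⟨fun z => (CompactCoherentification.mk C(X, Y)).symm (H (z.1, z.2.1)) z.2.2,
      by fun_prop⟩, fun z => hev (H.apply_zero z.1) z.2, fun z => hev (H.apply_one z.1) z.2,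
      fun s t ht x => ?_⟩
    exact hev ((H.eq_fst s ht).trans (q.2 t ht)) x
  · rintro ⟨K, h0, h1, hb⟩
    let K' : C((I × (Fin n → I)) × X, Y) := K.comp ⟨fun z => (z.1.1, z.1.2, z.2), by fun_prop⟩
    refine ⟨⟨⟨⟨fun z => of (K'.curry z),
      CompactCoherentification.continuous_rng_of_compactSpace.2 K'.curry.continuous⟩,
      fun t => ?_, fun t => ?_⟩, fun s t ht => ?_⟩⟩
    · exact congrArg of (ContinuousMap.ext fun x => h0 (t, x))
    · exact congrArg of (ContinuousMap.ext fun x => h1 (t, x))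
    · refine (congrArg of (ContinuousMap.ext fun x => ?_)).trans (q.2 t ht).symm
      exact hb s t ht x

end FunSpace

/-- Applying `H` at time `s` to `q` drags `r ∘ i ∘ q` back to `q`, while the boundary value follows
the track of `f` under `H`. -/
theorem Cube.homotopicAlong_of_homotopy {n : ℕ} {S Y : Type*} [TopologicalSpace S]
    [TopologicalSpace Y] {L : Set Y} {H : I × Y → Y} (hH : ContinuousOn H (univ ×ˢ L))
    (hH1 : ∀ y ∈ L, H (1, y) = y) {p q : C((Fin n → I) × S, Y)} (hq : ∀ z, q z ∈ L)
    (hp : ∀ z, p z = H (0, q z)) {γ : C(I × S, Y)} {f : C(S, Y)}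
    (hγ : ∀ s x, γ (s, x) = H (s, f x))
    (hqf : ∀ t ∈ Cube.boundary (Fin n), ∀ x, q (t, x) = f x) : HomotopicAlong γ p q :=
  ⟨⟨fun z => H (z.1, q z.2), hH.comp_continuous (by fun_prop) fun z => ⟨trivial, hq _⟩⟩,
    fun z => (hp z).symm, fun z => hH1 _ (hq z),
    fun s t ht x => by rw [hγ, ← hqf t ht x]; rfl⟩

/-! ### Comparison of homotopy classes at the stages and at the limit. -/

namespace InvLimit

theorem stageToLimit_stageTrans {ι : Type*} [Preorder ι] {K : ι → Type*}
    [∀ j, TopologicalSpace (K j)] {X Y : Type*} [TopologicalSpace X] [TopologicalSpace Y]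
    (p : ∀ ⦃i j : ι⦄, i ≤ j → C(K j, K i))
    [hp : InverseSystem fun (i j : ι) (hij : i ≤ j) => (p hij : K j → K i)]
    (h : ∀ j, C(X, K j)) (hh : ∀ i j (hij : i ≤ j) (x : X), p hij (h j x) = h i x) (n : ℕ)
    (m : ι) (fm : C(K m, Y)) (i j : Set.Ici m) (hij : i ≤ j)
    (x : StagePi p m fm n i) :
    stageToLimit p m fm n h hh j (stageTrans p m fm n i j hij x) =
      stageToLimit p m fm n h hh i x :=
  HomotopyGroup.push_push _ (precomp_stage p m fm hij) _ (precomp_limit p m fm h hh j) _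
    (precomp_limit p m fm h hh i) (FunSpace.precomp_precomp _ _ _ (hh i j hij)) x

variable {ι : Type*} [Preorder ι] [IsDirectedOrder ι] {K : ι → Type*} [∀ j, TopologicalSpace (K j)]
  [∀ j, CompactSpace (K j)] [∀ j, T2Space (K j)] {X : Type*} [TopologicalSpace X] [CompactSpace X]
  {p : ∀ ⦃i j : ι⦄, i ≤ j → C(K j, K i)}
  [hp : InverseSystem fun (i j : ι) (hij : i ≤ j) => (p hij : K j → K i)]
  {h : ∀ j, C(X, K j)} {hh : ∀ i j (hij : i ≤ j) (x : X), p hij (h j x) = h i x}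
  {Y : Type*} [TopologicalSpace Y] [T2Space Y] [CWComplex (univ : Set Y)] {n : ℕ}

/-- The surjectivity half. The approximation in `O` gives boundary value `r ∘ i ∘ f` after applying
`r`, so it must still be moved along the track of `H` to have boundary value `f`. -/
theorem exists_stage_homotopicAlong (hinj : Function.Injective (toInvLimit p h hh))
    (hsurj : Function.Surjective (toInvLimit p h hh)) {j : ι} (f : C(K j, Y))
    (F : C((Fin n → I) × X, Y))
    (hF : ∀ t ∈ Cube.boundary (Fin n), ∀ x, F (t, x) = f (h j x)) :
    ∃ k, ∃ hjk : j ≤ k, ∃ G : C((Fin n → I) × K k, Y),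
      (∀ t ∈ Cube.boundary (Fin n), ∀ y, G (t, y) = f (p hjk y)) ∧
      Cube.HomotopicAlong (Cube.constPath (f.comp (h j)))
        (G.comp ((ContinuousMap.id _).prodMap (h k))) F := by
  rcases isEmpty_or_nonempty Y with hY | hY
  · have hK : IsEmpty (K j) := ⟨fun y => isEmptyElim (f y)⟩
    have hX : IsEmpty X := ⟨fun x => isEmptyElim (h j x)⟩
    exact ⟨j, le_rfl, ⟨fun z => f z.2, by fun_prop⟩, fun t _ y => isEmptyElim y,
      Cube.constPath F, fun z => isEmptyElim z.2, fun z => isEmptyElim z.2,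
      fun s t _ x => isEmptyElim x⟩
  obtain ⟨E, _, _, _, O, i, r, H, hO, hi, hiO, hr, hH, hH0, hH1⟩ :=
    CWComplex.isOpenDominated_of_isCompact
      -- The range of `f` is included because the track of the boundary value is needed on all of `K
      -- k`, not only over `X`.
      ((isCompact_range F.continuous).union (isCompact_range f.continuous))
  have hFL : ∀ z, F z ∈ range F ∪ range f := fun z => Or.inl (mem_range_self z)
  have hfL : ∀ z, f z ∈ range F ∪ range f := fun z => Or.inr (mem_range_self z)
  let iF : C((Fin n → I) × X, E) := ⟨fun z => i (F z), hi.comp_continuous F.continuous hFL⟩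
  let g : C((Fin n → I) × K j, E) :=
    ⟨fun z => i (f z.2), hi.comp_continuous (by fun_prop) fun z => hfL z.2⟩
  obtain ⟨k, hjk, G', hG'O, hG'A, hG'⟩ := exists_stage_map hinj hsurj j hO
    (Cube.isClosed_boundary (Fin n)) iF (fun z => hiO (hFL z)) g fun t ht x =>
      congrArg i (hF t ht x)
  let rG : C((Fin n → I) × K k, Y) := ⟨fun z => r (G' z), hr.comp_continuous G'.continuous hG'O⟩
  let γ : C(I × K k, Y) := ⟨fun z => H (z.1, f (p hjk z.2)),
    hH.comp_continuous (by fun_prop) fun z => ⟨trivial, hfL _⟩⟩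
  obtain ⟨G, hG⟩ := Cube.exists_homotopicAlong γ rG fun t ht y => by
    change r (G' (t, y)) = H (0, f (p hjk y))
    rw [hG'A t ht y]
    exact (hH0 _ (hfL _)).symm
  refine ⟨k, hjk, G, fun t ht y => ?_, ?_⟩
  · obtain ⟨Θ, -, hΘ1, hΘ⟩ := hG
    rw [← hΘ1, hΘ 1 t ht y]
    exact hH1 _ (hfL _)
  let riF : C((Fin n → I) × X, Y) :=
    ⟨fun z => r (iF z), hr.comp_continuous iF.continuous fun z => hiO (hFL z)⟩
  let f₀ : C(X, Y) := ⟨fun x => r (i (f (h j x))),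
    hr.comp_continuous (hi.comp_continuous (by fun_prop) fun x => hfL _) fun x => hiO (hfL _)⟩
  have hγ : ∀ s x, (γ.comp ((ContinuousMap.id I).prodMap (h k))) (s, x) = H (s, f (h j x)) :=
    fun s x => by
      change H (s, f (p hjk (h k x))) = _
      rw [hh]
  refine (hG.precomp (h k)).transport (f₀ := f₀) (fun x => ?_) (fun x => ?_)
    (Cube.homotopicAlong_of_homotopy hH hH1 (p := riF) hFL (fun z => (hH0 _ (hFL z)).symm)
      (f := f.comp (h j)) hγ hF) ?_
  · rw [hγ]; exact hH0 _ (hfL _)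
  · rw [hγ]; exact hH1 _ (hfL _)
  -- The straight segment in `O`, run backwards because it must start at the approximation; it is
  -- constant on the boundary.
  · refine ⟨⟨fun z => r (iF z.2 + (unitInterval.symm z.1 : ℝ) •
      (G' (z.2.1, h k z.2.2) - iF z.2)), hr.comp_continuous (by fun_prop)
      fun z => hG' _ _ _⟩, fun z => ?_, fun z => ?_, fun s t ht x => ?_⟩
    · simp [rG, Prod.map]
    · simp [riF]
    · have e1 : G' (t, h k x) = i (f (h j x)) := by
        rw [hG'A t ht, hh]; rfl
      have e2 : iF (t, x) = i (f (h j x)) := congrArg i (hF t ht x)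
      simp [e1, e2, f₀, Cube.constPath]

/-- The injectivity half. The homotopy over `X` is approximated with `I × I^n` as parameter space,
exactly on both ends and on the sides, so the approximation already joins `r ∘ i ∘ G₀` to `r ∘ i ∘
G₁`. -/
theorem exists_stage_homotopicAlong_of_homotopicAlong
    (hinj : Function.Injective (toInvLimit p h hh))
    (hsurj : Function.Surjective (toInvLimit p h hh)) {j : ι} (f : C(K j, Y))
    (G₀ G₁ : C((Fin n → I) × K j, Y))
    (hG₀ : ∀ t ∈ Cube.boundary (Fin n), ∀ y, G₀ (t, y) = f y)
    (hG₁ : ∀ t ∈ Cube.boundary (Fin n), ∀ y, G₁ (t, y) = f y)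
    (hG : Cube.HomotopicAlong (Cube.constPath (f.comp (h j)))
      (G₀.comp ((ContinuousMap.id _).prodMap (h j)))
      (G₁.comp ((ContinuousMap.id _).prodMap (h j)))) :
    ∃ k, ∃ hjk : j ≤ k, Cube.HomotopicAlong (Cube.constPath (f.comp (p hjk)))
      (G₀.comp ((ContinuousMap.id _).prodMap (p hjk)))
      (G₁.comp ((ContinuousMap.id _).prodMap (p hjk))) := by
  obtain ⟨Θ, hΘ0, hΘ1, hΘ⟩ := hG
  rcases isEmpty_or_nonempty Y with hY | hY
  · have hK : IsEmpty (K j) := ⟨fun y => isEmptyElim (f y)⟩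
    exact ⟨j, le_rfl, Cube.constPath (G₀.comp ((ContinuousMap.id _).prodMap (p le_rfl))),
      fun z => isEmptyElim z.2, fun z => isEmptyElim z.2, fun s t _ x => isEmptyElim x⟩
  obtain ⟨E, _, _, _, O, i, r, H, hO, hi, hiO, hr, hH, hH0, hH1⟩ :=
    CWComplex.isOpenDominated_of_isCompact ((isCompact_range Θ.continuous).union
      ((isCompact_range G₀.continuous).union
        ((isCompact_range G₁.continuous).union (isCompact_range f.continuous))))
  set L := range Θ ∪ (range G₀ ∪ (range G₁ ∪ range f))
  have hΘL : ∀ z, Θ z ∈ L := fun z => Or.inl (mem_range_self z)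
  have hG₀L : ∀ z, G₀ z ∈ L := fun z => Or.inr (Or.inl (mem_range_self z))
  have hG₁L : ∀ z, G₁ z ∈ L := fun z => Or.inr (Or.inr (Or.inl (mem_range_self z)))
  have hfL : ∀ z, f z ∈ L := fun z => Or.inr (Or.inr (Or.inr (mem_range_self z)))
  let A : Set (I × (Fin n → I)) := {z | (z.1 = 0 ∨ z.1 = 1) ∨ z.2 ∈ Cube.boundary (Fin n)}
  have hA : IsClosed A := ((isClosed_eq continuous_fst continuous_const).union
    (isClosed_eq continuous_fst continuous_const)).union
    ((Cube.isClosed_boundary _).preimage continuous_snd)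
  let iΘ : C((I × (Fin n → I)) × X, E) := ⟨fun z => i (Θ (z.1.1, z.1.2, z.2)),
    hi.comp_continuous (by fun_prop) fun z => hΘL _⟩
  have hc₀ : Continuous fun z : (I × (Fin n → I)) × K j => i (G₀ (z.1.2, z.2)) :=
    hi.comp_continuous (by fun_prop) fun z => hG₀L _
  have hc₁ : Continuous fun z : (I × (Fin n → I)) × K j => i (G₁ (z.1.2, z.2)) :=
    hi.comp_continuous (by fun_prop) fun z => hG₁L _
  -- Linear interpolation serves only to extend the prescribed values on `A` continuously; elsewhere
  -- it may leave `O`.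
  let g : C((I × (Fin n → I)) × K j, E) := ⟨fun z => i (G₀ (z.1.2, z.2)) +
    (z.1.1 : ℝ) • (i (G₁ (z.1.2, z.2)) - i (G₀ (z.1.2, z.2))),
    hc₀.add (Continuous.smul (by fun_prop) (hc₁.sub hc₀))⟩
  have hg0 : ∀ t y, g ((0, t), y) = i (G₀ (t, y)) := fun t y => by simp [g]
  have hg1 : ∀ t y, g ((1, t), y) = i (G₁ (t, y)) := fun t y => by simp [g]
  have hgb : ∀ s, ∀ t ∈ Cube.boundary (Fin n), ∀ y, g ((s, t), y) = i (f y) :=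
    fun s t ht y => by simp [g, hG₀ t ht, hG₁ t ht]
  obtain ⟨k, hjk, G, hGO, hGA, -⟩ := exists_stage_map hinj hsurj j hO hA iΘ
    (fun z => hiO (hΘL _)) g (by
      rintro ⟨s, t⟩ ((h' | h') | h') x <;> simp only at h'
      · rw [h', hg0]
        exact congrArg i (hΘ0 (t, x))
      · rw [h', hg1]
        exact congrArg i (hΘ1 (t, x))
      · rw [hgb s t h']
        exact congrArg i (hΘ s t h' x))
  refine ⟨k, hjk, ?_⟩
  have hback : ∀ (u : C((Fin n → I) × K k, Y)), (∀ z, u z ∈ L) →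
      Continuous fun z => r (i (u z)) := fun u hu =>
    hr.comp_continuous (hi.comp_continuous u.continuous hu) fun z => hiO (hu z)
  have hp₀ : ∀ z, (G₀.comp ((ContinuousMap.id _).prodMap (p hjk))) z ∈ L := fun z => hG₀L _
  have hp₁ : ∀ z, (G₁.comp ((ContinuousMap.id _).prodMap (p hjk))) z ∈ L := fun z => hG₁L _
  let γ : C(I × K k, Y) := ⟨fun z => H (z.1, f (p hjk z.2)),
    hH.comp_continuous (by fun_prop) fun z => ⟨trivial, hfL _⟩⟩
  let f₀ : C(K k, Y) := ⟨fun y => r (i (f (p hjk y))),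
    hr.comp_continuous (hi.comp_continuous (by fun_prop) fun y => hfL _) fun y => hiO (hfL _)⟩
  refine Cube.HomotopicAlong.transport (γ := γ) (f₀ := f₀) (f₁ := f.comp (p hjk))
    (fun y => hH0 _ (hfL _)) (fun y => hH1 _ (hfL _))
    (Cube.homotopicAlong_of_homotopy hH hH1 (p := ⟨_, hback _ hp₀⟩) hp₀
      (fun z => (hH0 _ (hp₀ z)).symm) (f := f.comp (p hjk)) (fun s x => rfl)
      fun t ht y => hG₀ t ht _)
    (Cube.homotopicAlong_of_homotopy hH hH1 (p := ⟨_, hback _ hp₁⟩) hp₁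
      (fun z => (hH0 _ (hp₁ z)).symm) (f := f.comp (p hjk)) (fun s x => rfl)
      fun t ht y => hG₁ t ht _) ?_
  refine ⟨⟨fun z => r (G ((z.1, z.2.1), z.2.2)), hr.comp_continuous (by fun_prop)
    fun z => hGO _⟩, fun z => ?_, fun z => ?_, fun s t ht y => ?_⟩
  · exact congrArg r ((hGA (0, z.1) (Or.inl (Or.inl rfl)) z.2).trans (hg0 _ _))
  · exact congrArg r ((hGA (1, z.1) (Or.inl (Or.inr rfl)) z.2).trans (hg1 _ _))
  · exact congrArg r ((hGA (s, t) (Or.inr ht) y).trans (hgb s t ht _))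

variable (p h hh) (m : ι) (fm : C(K m, Y)) (n)

variable [T2Space X]

theorem exists_stageToLimit_eq (hlim : Function.Bijective (toInvLimit p h hh))
    (α : π_ n (FunSpace X Y) (FunSpace.of (fm.comp (h m)))) :
    ∃ j x, stageToLimit p m fm n h hh j x = α := by
  induction α using Quotient.inductionOn with
  | _ q =>
    obtain ⟨k, hmk, G, hG, hGq⟩ := exists_stage_homotopicAlong hlim.1 hlim.2 fm
      (FunSpace.uncurryLoop q) (FunSpace.uncurryLoop_boundary q)
    obtain ⟨u, rfl⟩ := FunSpace.exists_uncurryLoop_eq (f := stageMap p m fm ⟨k, hmk⟩) G hG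
    refine ⟨⟨k, hmk⟩, Quotient.mk _ u, Quotient.sound ?_⟩
    exact (FunSpace.homotopic_iff _ _).2 hGq

theorem exists_stageTrans_eq (hlim : Function.Bijective (toInvLimit p h hh)) (j : Set.Ici m)
    (x y : StagePi p m fm n j)
    (hxy : stageToLimit p m fm n h hh j x = stageToLimit p m fm n h hh j y) :
    ∃ k, ∃ hjk : j ≤ k, stageTrans p m fm n j k hjk x = stageTrans p m fm n j k hjk y := by
  induction x using Quotient.inductionOn with
  | _ q =>
  induction y using Quotient.inductionOn with
  | _ q' =>
    have e : Cube.HomotopicAlong (Cube.constPath (fm.comp (h m)))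
        ((FunSpace.uncurryLoop q).comp ((ContinuousMap.id _).prodMap (h j)))
        ((FunSpace.uncurryLoop q').comp ((ContinuousMap.id _).prodMap (h j))) :=
      (FunSpace.homotopic_iff _ _).1 (Quotient.exact hxy)
    have hf : (stageMap p m fm j).comp (h j) = fm.comp (h m) :=
      ContinuousMap.ext fun x => congrArg fm (hh m j j.2 x)
    rw [← hf] at e
    obtain ⟨k, hjk, hk⟩ := exists_stage_homotopicAlong_of_homotopicAlong hlim.1 hlim.2
      (stageMap p m fm j) (FunSpace.uncurryLoop q) (FunSpace.uncurryLoop q')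
      (FunSpace.uncurryLoop_boundary q) (FunSpace.uncurryLoop_boundary q') e
    have hf' : (stageMap p m fm j).comp (p hjk) = stageMap p m fm ⟨k, le_trans j.2 hjk⟩ :=
      ContinuousMap.ext fun x => congrArg fm (hp.map_map j.2 hjk x)
    rw [hf'] at hk
    exact ⟨⟨k, le_trans j.2 hjk⟩, hjk, Quotient.sound ((FunSpace.homotopic_iff _ _).2 hk)⟩

end InvLimit

/-! ### Passage to the direct limit. -/

theorem theorem6p5 {ι : Type*} [Preorder ι] [IsDirectedOrder ι]
    {K : ι → Type*} [∀ j, TopologicalSpace (K j)] [∀ j, T2Space (K j)]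
    [∀ j, CWComplex (Set.univ : Set (K j))] [∀ j, CWComplex.Finite (Set.univ : Set (K j))]
    (p : ∀ ⦃i j : ι⦄, i ≤ j → C(K j, K i))
    [InverseSystem fun (i j : ι) (hij : i ≤ j) => (p hij : K j → K i)]
    {X : Type*} [TopologicalSpace X] [CompactSpace X] [T2Space X]
    (h : ∀ j, C(X, K j)) (hh : ∀ i j (hij : i ≤ j) (x : X), p hij (h j x) = h i x)
    (hlim : IsHomeomorph (toInvLimit p h hh))
    {Y : Type*} [TopologicalSpace Y] [T2Space Y] [CWComplex (Set.univ : Set Y)]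
    (m : ι) (fm : C(K m, Y)) :
    (∃ φ : DirectLimit (StagePi p m fm 0) (stageTrans p m fm 0) ≃
        π_ 0 (FunSpace X Y) (FunSpace.of (fm.comp (h m))),
      (∀ j x, φ (Quotient.mk _ ⟨j, x⟩) = stageToLimit p m fm 0 h hh j x) ∧
      ∀ j, φ (Quotient.mk _ ⟨j, default⟩) = default) ∧
    ∀ n : ℕ, ∃ φ : DirectLimit (StagePi p m fm (n + 1)) (stageTransHom p m fm n) ≃*
        π_ (n + 1) (FunSpace X Y) (FunSpace.of (fm.comp (h m))),
      ∀ j x, φ (Quotient.mk _ ⟨j, x⟩) = stageToLimit p m fm (n + 1) h hh j x := by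
  have hK : ∀ j, CompactSpace (K j) := fun j => CWComplex.compactSpace_of_finite
  have hb : Function.Bijective (toInvLimit p h hh) := hlim.bijective
  refine ⟨?_, fun n => ?_⟩
  · refine ⟨Equiv.ofBijective (DirectLimit.lift _ (stageToLimit p m fm 0 h hh) fun i j hij x =>
      (InvLimit.stageToLimit_stageTrans p h hh 0 m fm i j hij x).symm) ⟨?_, ?_⟩,
      fun j x => rfl, fun j => HomotopyGroup.push_default _ (precomp_limit p m fm h hh j)⟩
    · refine DirectLimit.induction₂ _ fun j x y hxy => ?_
      obtain ⟨k, hjk, hk⟩ := InvLimit.exists_stageTrans_eq p h hh 0 m fm hb j x y hxy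
      exact Quotient.sound ⟨k, hjk, hjk, hk⟩
    · intro α
      obtain ⟨j, x, rfl⟩ := InvLimit.exists_stageToLimit_eq p h hh 0 m fm hb α
      exact ⟨Quotient.mk _ ⟨j, x⟩, rfl⟩
  · let φ : DirectLimit (StagePi p m fm (n + 1)) (stageTransHom p m fm n) →
        π_ (n + 1) (FunSpace X Y) (FunSpace.of (fm.comp (h m))) :=
      DirectLimit.lift _ (stageToLimit p m fm (n + 1) h hh) fun i j hij x =>
        (InvLimit.stageToLimit_stageTrans p h hh (n + 1) m fm i j hij x).symm
    have hφ : Function.Bijective φ := by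
      constructor
      · refine DirectLimit.induction₂ _ fun j x y hxy => ?_
        obtain ⟨k, hjk, hk⟩ := InvLimit.exists_stageTrans_eq p h hh (n + 1) m fm hb j x y hxy
        exact Quotient.sound ⟨k, hjk, hjk, hk⟩
      · intro α
        obtain ⟨j, x, rfl⟩ := InvLimit.exists_stageToLimit_eq p h hh (n + 1) m fm hb α
        exact ⟨Quotient.mk _ ⟨j, x⟩, rfl⟩
    refine ⟨MulEquiv.mk (Equiv.ofBijective φ hφ) ?_, fun j x => rfl⟩
    refine DirectLimit.induction₂ _ fun j x y => ?_
    rw [DirectLimit.mul_def]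
    -- Both factors are represented at a common stage, where the product in the direct limit is
    -- computed.
    exact HomotopyGroup.push_mul _ (precomp_limit p m fm h hh j) x y
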